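/- Let $T>0$. Let $U\subseteq\mathbb R^m$ be the closure of a (nonempty) connected open set and $A\subset\mathbb R^l$ compact. Let $\tilde f:\mathbb R^n\times U\times A\to\mathbb R^n$ be locally Lipschitz in $(x,z)\in\mathbb R^n\times U$ uniformly in $a\in A$, continuous in $a$, and such that $|\tilde f(x,z,a)|\le M(1+|(x,z)|)$ for some $M>0$. Let $\tilde g_1,\dots,\tilde g_m:\mathbb R^n\times\mathbb R^m\to\mathbb R^n$ be of class $C^2$, and put $f=(\tilde f,0)$, $g_\alpha=(\tilde g_\alpha,\mathbf e_\alpha)$ (vector fields with values in $\mathbb R^{n+m}$). Assume: (a) $[g_\alpha,g_\beta]=0$ at all points $(x,sz)$ with $x\in\mathbb R^n$, $z\in U$, $s\in[0,1]$ (that is, on $\mathbb R^n\times U$ if $U$ is star-shaped about $0$), for all $\alpha,\beta$; (b) for all $x\in\mathbb R^n$ and $z\in U$ the integral curves of $-\sum_k z^kg_k$ from $(x,z)$ and of $\sum_k z^kg_k$ from $(x,0)$ exist on the time interval $[0,1]$; (c) trajectories are bounded a priori: for every $R$ there is $N$ such that, for all $0\le S\le T$, $x_0\in\mathbb R^n$,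 $w\in C^1([0,T];U)$ and $a\in L^1(0,T;A)$ with $|x_0|+|w(t)|\le R$ on $[0,T]$, every absolutely continuous solution $(x,z)$ on $[0,S]$ of $$(\dot x,\dot z)=f(x,z,a)+\sum_{i=1}^m\dot w^i\,g_i(x,z),\qquad (x,z)(0)=(x_0,w(0)),\tag{1}$$ satisfies $|x(t)|\le N$ on $[0,S]$. For $(x,z)\in\mathbb R^n\times U$ let $\varphi(x,z)\in\mathbb R^n$ consist of the first $n$ components of $\exp\big(-\sum_k z^kg_k\big)(x,z)$, and $\phi(x,z)=(\varphi(x,z),z)$; let $\tilde F(\xi,\eta,a)=\frac{\partial\varphi}{\partial x}(x,z)\,\tilde f(x,z,a)$ with $(x,z)=\phi^{-1}(\xi,\eta)$. Let $x_0\in\mathbb R^n$, let $a\in L^1(0,T;A)$, and let $u:[0,T]\to U$ be integrable (defined at every point of $[0,T]$) with values in the closure of some bounded connected open set $V\subseteq U$ (if $U$ is bounded this is no restriction; if $U=\mathbb R^m$ it says that $u$ is bounded). An integrable function $(x,z):[0,T]\to\mathbb R^n\times\mathbb R^m$, defined at every point, is called a generalized solution pointwise defined on $[0,T]$ of the impulsive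 Cauchy problem with input $(x_0,u,a)$ if for every $\tau\in[0,T]$ there are controls $w_k\in C^1([0,T];U)$ and absolutely continuous solutions $(x_k,z_k)$ on $[0,T]$ of (1) with $w=w_k$, with values bounded uniformly in $k$, such that $w_k\to u$ and $(x_k,z_k)\to(x,z)$ in $L^1(0,T)$ and also pointwise at the times $0$ and $\tau$. Then $\phi$ is a bijection of $\mathbb R^n\times U$ onto itself, and there is exactly one generalized solution $(x,z)$ pointwise defined on $[0,T]$ with input $(x_0,u,a)$ (uniqueness meaning equality at every point of $[0,T]$). Moreover there is exactly one absolutely continuous $\xi:[0,T]\to\mathbb R^n$ solving $$\xi(t)=\varphi(x_0,u(0))+\int_0^t\tilde F(\xi(s),u(s),a(s))\,ds,\qquad t\in[0,T],$$ and $$(x(\tau),z(\tau))=\phi^{-1}(\xi(\tau),u(\tau))\quad\text{for all }\tau\in[0,T].$$ -/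

import Mathlib

open MeasureTheory Set Filter Topology

noncomputable section

namespace Impulsive

/-- The Euclidean space `ℝ^d`. -/
abbrev Vec (d : ℕ) : Type := EuclideanSpace ℝ (Fin d)

variable {n m l : ℕ}

/-! ### Vector fields on `ℝ^n × ℝ^m` -/

/-- The augmented impulsive vector field `g_α = (g̃_α, e_α)`. -/
def augG (g : Fin m → Vec n × Vec m → Vec n) (α : Fin m) (p : Vec n × Vec m) :
    Vec n × Vec m :=
  (g α p, EuclideanSpace.single α 1)

/-- The augmented drift `f = (f̃, 0)`. -/
def augF (f : Vec n × Vec m → Vec l → Vec n) (p : Vec n × Vec m) (a : Vec l) :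
    Vec n × Vec m :=
  (f p a, 0)

/-- The combination `∑_k c^k g_k` with constant coefficients. -/
def combG (g : Fin m → Vec n × Vec m → Vec n) (c : Vec m) (p : Vec n × Vec m) :
    Vec n × Vec m :=
  ∑ k, c k • augG g k p

/-- `γ` is an integral curve of `∑_k c^k g_k` on the time interval `[0,1]` issuing from `p`. -/
def IsFlowLine (g : Fin m → Vec n × Vec m → Vec n) (c : Vec m) (p : Vec n × Vec m)
    (γ : ℝ → Vec n × Vec m) : Prop :=
  γ 0 = p ∧ IsIntegralCurveOn γ (fun _ => combG g c) (Icc 0 1)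

open Classical in
/-- The exponential `exp(∑_k c^k g_k)(p)`: the value at time `1` of the integral curve of
`∑_k c^k g_k` issuing from `p` (and `p` itself if there is no such curve on `[0,1]`). -/
def expG (g : Fin m → Vec n × Vec m → Vec n) (c : Vec m) (p : Vec n × Vec m) :
    Vec n × Vec m :=
  if h : ∃ γ, IsFlowLine g c p γ then h.choose 1 else p

/-! ### The change of coordinates and the transformed drift -/

/-- `φ(x,z) = Pr_x (exp(-z^k g_k)(x,z))`, the first `n` components of the change of
coordinates. -/
def straighten (g : Fin m → Vec n × Vec m → Vec n) (p : Vec n × Vec m) : Vec n :=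
  (expG g (-p.2) p).1

/-- The change of coordinates `φ(x,z) = (φ^1(x,z),…,φ^n(x,z),z)`. -/
def coordChange (g : Fin m → Vec n × Vec m → Vec n) (p : Vec n × Vec m) : Vec n × Vec m :=
  (straighten g p, p.2)

/-- The inverse of the change of coordinates, as a map of `ℝ^n × U` into itself. -/
def coordChangeInv (g : Fin m → Vec n × Vec m → Vec n) (U : Set (Vec m)) :
    Vec n × Vec m → Vec n × Vec m :=
  Function.invFunOn (coordChange g) (univ ×ˢ U)

/-- The transformed drift `F̃(ξ,η,a) = ∂φ/∂x (x,z) f̃(x,z,a)`, where `(x,z) = φ⁻¹(ξ,η)`. -/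
def transF (f : Vec n × Vec m → Vec l → Vec n) (g : Fin m → Vec n × Vec m → Vec n)
    (U : Set (Vec m)) (q : Vec n × Vec m) (a : Vec l) : Vec n :=
  let p := coordChangeInv g U q
  fderiv ℝ (fun x => straighten g (x, p.2)) p.1 (f p a)

/-! ### Solutions of ordinary differential equations -/

/-- `y` is an absolutely continuous (Carathéodory) solution on `[0,S]` of
`ẏ(t) = rhs t (y t)`, `y 0 = y₀`. -/
structure IsACSolution {E : Type*} [NormedAddCommGroup E] [NormedSpace ℝ E]
    (rhs : ℝ → E → E) (S : ℝ) (y₀ : E) (y : ℝ → E) : Prop where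
  ac : AbsolutelyContinuousOnInterval y 0 S
  integrable : IntervalIntegrable (fun t => rhs t (y t)) volume 0 S
  eq : ∀ t ∈ Icc 0 S, y t = y₀ + ∫ s in (0 : ℝ)..t, rhs s (y s)

/-- Ordinary controls: (representatives of) elements of `L^1(0,T;A)`. -/
def IsOrdinaryControl (A : Set (Vec l)) (T : ℝ) (a : ℝ → Vec l) : Prop :=
  IntegrableOn a (Icc 0 T) ∧ ∀ᵐ t ∂(volume.restrict (Icc 0 T)), a t ∈ A

/-- Controls of class `C^1([0,T];U)`. -/
def IsC1Control (U : Set (Vec m)) (T : ℝ) (w : ℝ → Vec m) : Prop :=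
  ContDiffOn ℝ 1 w (Icc 0 T) ∧ ∀ t ∈ Icc 0 T, w t ∈ U

/-- `y = (x,z)` solves on `[0,S]`, `S ≤ T`, the augmented Cauchy problem
`(ẋ,ż) = f(x,z,a) + ∑_i ẇ^i g_i(x,z)`, `(x,z)(0) = (x₀, w(0))`, for a control
`w` which is differentiable on `[0,T]`. -/
def IsSmoothSolution (f : Vec n × Vec m → Vec l → Vec n) (g : Fin m → Vec n × Vec m → Vec n)
    (T S : ℝ) (x₀ : Vec n) (w : ℝ → Vec m) (a : ℝ → Vec l) (y : ℝ → Vec n × Vec m) : Prop :=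
  IsACSolution (fun t p => augF f p (a t) + combG g (derivWithin w (Icc 0 T) t) p)
    S (x₀, w 0) y

/-- `ξ` solves on `[0,T]` the transformed Cauchy problem `ξ̇ = F̃(ξ,η,a)`,
`ξ(0) = φ(x₀,u(0))`, with `η = u`. -/
def IsTransformedSolution (f : Vec n × Vec m → Vec l → Vec n)
    (g : Fin m → Vec n × Vec m → Vec n) (U : Set (Vec m))
    (T : ℝ) (x₀ : Vec n) (u : ℝ → Vec m) (a : ℝ → Vec l) (ξ : ℝ → Vec n) : Prop :=
  IsACSolution (fun t q => transF f g U (q, u t) (a t)) T (straighten g (x₀, u 0)) ξ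

/-! ### Generalized solutions -/

/-- Convergence in `L^1_J` on `[0,T]`: convergence in `L^1(0,T)` and at every point of `J`. -/
def TendstoL1At {E : Type*} [NormedAddCommGroup E] (T : ℝ) (J : Set ℝ)
    (y : ℕ → ℝ → E) (y' : ℝ → E) : Prop :=
  Tendsto (fun k => eLpNorm (y k - y') 1 (volume.restrict (Icc 0 T))) atTop (𝓝 0) ∧
    ∀ t ∈ J, Tendsto (fun k => y k t) atTop (𝓝 (y' t))

/-- `p = (x,z)` is a generalized solution, pointwise defined on `I ⊆ [0,T]` (`0 ∈ I`), of the
impulsive Cauchy problem with input `(x₀,u,a)`: it is integrable and, for every `τ ∈ I`, there are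
`C^1` controls `w_k` with values in `U` and solutions `y_k = (x_k,z_k)` of the corresponding
augmented problems, with uniformly bounded values, such that `w_k → u` and `(x_k,z_k) → (x,z)`
in `L^1` and at the times `0` and `τ`. -/
def IsGeneralizedSolution (f : Vec n × Vec m → Vec l → Vec n)
    (g : Fin m → Vec n × Vec m → Vec n) (U : Set (Vec m))
    (T : ℝ) (I : Set ℝ) (x₀ : Vec n) (u : ℝ → Vec m) (a : ℝ → Vec l)
    (p : ℝ → Vec n × Vec m) : Prop :=
  IntegrableOn p (Icc 0 T) ∧
    ∀ τ ∈ I, ∃ (w : ℕ → ℝ → Vec m) (y : ℕ → ℝ → Vec n × Vec m),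
      (∀ k, IsC1Control U T (w k)) ∧
      (∀ k, IsSmoothSolution f g T T x₀ (w k) a (y k)) ∧
      (∃ C : ℝ, ∀ k, ∀ t ∈ Icc 0 T, ‖y k t‖ ≤ C) ∧
      TendstoL1At T {0, τ} w u ∧
      TendstoL1At T {0, τ} y p

/-! ### Standing assumptions -/

/-- Assumptions on the drift `f̃` on `ℝ^n × U × A`: locally Lipschitz in `(x,u)` uniformly in `a`,
continuous in `a`, of at most linear growth. -/
structure DriftAssumption (f : Vec n × Vec m → Vec l → Vec n) (U : Set (Vec m))
    (A : Set (Vec l)) : Prop where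
  lipschitz : ∀ p ∈ (univ : Set (Vec n)) ×ˢ U, ∃ K : NNReal,
    ∃ V ∈ 𝓝[(univ : Set (Vec n)) ×ˢ U] p, ∀ a ∈ A, LipschitzOnWith K (fun q => f q a) V
  continuous : ∀ p ∈ (univ : Set (Vec n)) ×ˢ U, ContinuousOn (f p) A
  growth : ∃ M : ℝ, 0 < M ∧ ∀ p ∈ (univ : Set (Vec n)) ×ˢ U, ∀ a ∈ A, ‖f p a‖ ≤ M * (1 + ‖p‖)

/-- Assumptions on the fields `g_α`: `g̃_α` is `C^2`, the `g_α` commute over the points `s z`,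
`z ∈ U`, `0 ≤ s ≤ 1` (which is `U` itself if `U` is star-shaped about `0`), and the flow lines
used in `φ` and in `φ⁻¹`, which lie over these points, exist. -/
structure FieldAssumption (g : Fin m → Vec n × Vec m → Vec n) (U : Set (Vec m)) : Prop where
  smooth : ∀ α, ContDiff ℝ 2 (g α)
  commute : ∀ α β, ∀ x : Vec n, ∀ z ∈ U, ∀ s ∈ Icc (0 : ℝ) 1,
    VectorField.lieBracket ℝ (augG g α) (augG g β) (x, s • z) = 0
  flow : ∀ x : Vec n, ∀ z ∈ U, ∃ γ, IsFlowLine g (-z) (x, z) γ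
  flow_inv : ∀ x : Vec n, ∀ z ∈ U, ∃ γ, IsFlowLine g z (x, 0) γ

/-- A priori bound: for every `R` there is `N` such that `|x| ≤ N` for every trajectory, on any
`[0,S] ⊆ [0,T]`, of a `C^1` control `w` and an ordinary control `a` with `|x₀| + |w| ≤ R`. -/
def AprioriBound (f : Vec n × Vec m → Vec l → Vec n) (g : Fin m → Vec n × Vec m → Vec n)
    (U : Set (Vec m)) (A : Set (Vec l)) (T : ℝ) : Prop :=
  ∀ R : ℝ, ∃ N : ℝ, ∀ (x₀ : Vec n) (w : ℝ → Vec m) (a : ℝ → Vec l) (S : ℝ)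
    (y : ℝ → Vec n × Vec m), IsC1Control U T w → IsOrdinaryControl A T a →
    (∀ t ∈ Icc 0 T, ‖x₀‖ + ‖w t‖ ≤ R) → S ∈ Icc 0 T →
    IsSmoothSolution f g T S x₀ w a y → ∀ t ∈ Icc 0 S, ‖(y t).1‖ ≤ N

/-- Impulsive controls pointwise defined on `[0,T]`: integrable, with values in the closure of
some bounded connected open subset of `U`. -/
def IsImpulsiveControl (U : Set (Vec m)) (T : ℝ) (u : ℝ → Vec m) : Prop :=
  IntegrableOn u (Icc 0 T) ∧
    ∃ V : Set (Vec m), IsOpen V ∧ IsConnected V ∧ Bornology.IsBounded V ∧ V ⊆ U ∧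
      ∀ t ∈ Icc 0 T, u t ∈ closure V

end Impulsive

end

/-!
The fields `g_α` commute, so the coordinate change `φ` straightens them: with `η = z` and `ξ =
φ(x,z)`, a `C^1` control enters the equation for `ξ` only through its values, not through its
derivative. The transformed problem `ξ' = F̃(ξ,u,a)` is an ordinary Carathéodory problem that
makes sense for an arbitrary bounded measurable `u`, and its solution depends continuously on `u`
in `L^1`. Generalized solutions are the images of its solution under `φ⁻¹`.

*The flow.* All exponentials are time-one maps of the single autonomous field `(p,c) ↦ (∑_k c^k
g_k(p), 0)` (`stateField`). The initial points that matter are `((x,z),-z)` and `((ξ,0),z)` with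
`z ∈ U`, and they do not fill an open set: regularity is stated relative to the set of points from
which the flow exists on `[0,1]` (`exists_flow_estimates`), so that the openness of this set plays
no role. There the flow is locally Lipschitz, it is differentiable with a quadratic remainder, and
its derivative, the solution of the variational equation, is locally Lipschitz. Since the field is
`C^2`, each of these is one application of Gronwall's inequality.

*Straightening.* Let `ψ(·,z)` (`unstraighten`) denote the inverse of `φ(·,z)` (`straighten`); it
is the flow in the opposite direction. Commutativity gives `∂ψ/∂z · ζ = ∑_k ζ^k g̃_k(ψ,z)`
(`unstraightenDeriv_snd`), because the variational equation along a flow line `γ` has the explicit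
solution `s ↦ s ∑_k ζ^k g_k(γ(s))`. Differentiating `x = ψ(ξ,w)` along absolutely continuous
curves shows that, for `C^1` controls, the augmented and the transformed problem are equivalent
(`IsSmoothSolution.straighten`, `isSmoothSolution_unstraighten`).

*The transformed problem.* The transformed drift is Lipschitz on bounded parts of `ℝ^n × U`,
uniformly in the control (`exists_transF_estimates`). After truncation of the state it is globally
Lipschitz, so solutions exist (`exists_isClampedSolution`) and are stable
(`exists_clamped_stability`). For `C^1` controls the a priori bound, carried to the new
coordinates, keeps solutions away from the truncation; approximation extends this to `u`.

*Approximation.* An integrable `u` with values in the closure of a connected open set `V` is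
approximated by `C^1` functions with values in `V` by factoring simple functions through a `C^1`
path in `V` (`exists_contDiff_lintegral_sub_le`). Convergence at the times `0` and `τ` is included
by adding Dirac masses to the measure (`exists_contDiff_tendstoL1At`).
-/

noncomputable section

namespace Impulsive

/-! ### Tools for ordinary differential equations -/

/-- Gronwall's inequality in integral form. -/
theorem le_mul_exp_of_le_add_integral {v : ℝ → ℝ} {T δ L : ℝ} (hL : 0 ≤ L)
    (hv : ContinuousOn v (Icc 0 T))
    (h : ∀ t ∈ Icc 0 T, v t ≤ δ + L * ∫ s in (0 : ℝ)..t, v s) :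
    ∀ t ∈ Icc 0 T, v t ≤ δ * Real.exp (L * t) := by
  intro t₀ ht₀
  have hT : (0 : ℝ) ≤ T := ht₀.1.trans ht₀.2
  -- a continuous extension of `v` to the line has a primitive that is differentiable everywhere
  set w : ℝ → ℝ := IccExtend hT ((Icc 0 T).domRestrict v) with hw
  have hwc : Continuous w := by
    exact (continuousOn_iff_continuous_domRestrict.1 hv).Icc_extend'
  have hwv : ∀ t ∈ Icc 0 T, w t = v t := fun t ht => by
    rw [hw, IccExtend_of_mem hT _ ht]; rfl
  have hint : ∀ t ∈ Icc 0 T, ∫ s in (0 : ℝ)..t, v s = ∫ s in (0 : ℝ)..t, w s := by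
    intro t ht
    refine intervalIntegral.integral_congr fun s hs => ?_
    rw [uIcc_of_le ht.1] at hs
    exact (hwv s ⟨hs.1, hs.2.trans ht.2⟩).symm
  have hd : ∀ t, HasDerivAt (fun t => δ + L * ∫ s in (0 : ℝ)..t, w s) (L * w t) t := fun t =>
    ((intervalIntegral.integral_hasDerivAt_right (hwc.intervalIntegrable _ _)
      (hwc.stronglyMeasurableAtFilter _ _) hwc.continuousAt).const_mul L).const_add δ
  have key := le_gronwallBound_of_liminf_deriv_right_le
    (f := fun t => δ + L * ∫ s in (0 : ℝ)..t, w s) (f' := fun t => L * w t)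
    (δ := δ) (K := L) (ε := 0) (a := 0) (b := T)
    (fun t _ => (hd t).continuousAt.continuousWithinAt)
    (fun t _ r hr => (hd t).hasDerivWithinAt.liminf_right_slope_le hr) (by simp)
    (fun t ht => by
      have h1 := h t ⟨ht.1, ht.2.le⟩
      rw [hint t ⟨ht.1, ht.2.le⟩, ← hwv t ⟨ht.1, ht.2.le⟩] at h1
      simpa using mul_le_mul_of_nonneg_left h1 hL) t₀ ht₀
  rw [gronwallBound_ε0, sub_zero] at key
  refine le_trans ?_ key
  have h1 := h t₀ ht₀
  rwa [hint t₀ ht₀] at h1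

/-- Gronwall's inequality in differential form on `[0,S] ⊆ [0,1]`, with a simplified constant.
The derivatives are taken within `[0,1]`, so that the case `S = 0` makes sense. -/
theorem norm_le_mul_exp_of_norm_deriv_le {E : Type*} [NormedAddCommGroup E] [NormedSpace ℝ E]
    {f f' : ℝ → E} {δ K ε S : ℝ} (hδ : 0 ≤ δ) (hK : 0 ≤ K) (hε : 0 ≤ ε) (hS : S ≤ 1)
    (hf : ∀ s ∈ Icc 0 S, HasDerivWithinAt f (f' s) (Icc 0 1) s) (h0 : ‖f 0‖ ≤ δ)
    (hb : ∀ s ∈ Icc 0 S, ‖f' s‖ ≤ K * ‖f s‖ + ε) :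
    ∀ s ∈ Icc 0 S, ‖f s‖ ≤ (δ + ε) * Real.exp K := by
  intro s hs
  have h1 := norm_le_gronwallBound_of_norm_deriv_right_le (f := f) (f' := f') (δ := δ) (K := K)
    (ε := ε) (a := 0) (b := S)
    (fun t ht => ((hf t ht).mono (Icc_subset_Icc_right hS)).continuousWithinAt)
    (fun t ht => ((hf t ⟨ht.1, ht.2.le⟩).mono_of_mem_nhdsWithin
      (Icc_mem_nhdsGE_of_mem ⟨ht.1, ht.2.trans_le hS⟩))) h0
    (fun t ht => hb t ⟨ht.1, ht.2.le⟩) s hs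
  have h2 := gronwallBound_mono hδ hε hK (show s - 0 ≤ 1 by linarith [hs.2])
  refine h1.trans (h2.trans ?_)
  rcases eq_or_lt_of_le hK with rfl | hK
  · simp [gronwallBound_K0]
  · rw [gronwallBound_of_K_ne_0 hK.ne']
    have h3 : Real.exp K - 1 ≤ K * Real.exp K := by
      have := Real.add_one_le_exp (-K)
      have h4 := mul_le_mul_of_nonneg_right this (Real.exp_pos K).le
      rw [← Real.exp_add] at h4
      simp only [neg_add_cancel, Real.exp_zero] at h4
      linarith
    have h5 : ε / K * (Real.exp K - 1) ≤ ε * Real.exp K := by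
      rw [div_mul_eq_mul_div, div_le_iff₀ hK]
      nlinarith
    simp only [mul_one]
    linarith

/-- Continuous induction: if a bound by `B` on `[0,S]` always improves to the bound `c < B`
at `S`, then the better bound holds throughout. -/
theorem forall_le_of_forall_improve {f : ℝ → ℝ} {T c B : ℝ} (hf : ContinuousOn f (Icc 0 T))
    (hcB : c < B) (h0 : f 0 ≤ B)
    (h : ∀ S ∈ Icc 0 T, (∀ t ∈ Icc 0 S, f t ≤ B) → f S ≤ c) : ∀ t ∈ Icc 0 T, f t ≤ c := by
  have hlt : ∀ t ∈ Icc 0 T, f t < B := by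
    by_contra! hcon
    obtain ⟨t₁, ht₁, hft₁⟩ := hcon
    -- the first time at which `f` reaches `B`
    have hcomp : IsCompact (Icc 0 T ∩ f ⁻¹' Ici B) :=
      isCompact_Icc.of_isClosed_subset (hf.preimage_isClosed_of_isClosed isClosed_Icc isClosed_Ici)
        inter_subset_left
    obtain ⟨m, ⟨hm, hmB⟩, hmin⟩ := hcomp.exists_isLeast ⟨t₁, ht₁, hft₁⟩
    have hbelow : ∀ t ∈ Ico 0 m, f t ≤ B := fun t ht => by
      by_contra! hc
      exact absurd (hmin ⟨⟨ht.1, ht.2.le.trans hm.2⟩, hc.le⟩) (not_le.2 ht.2)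
    have hmle : f m ≤ B := by
      rcases eq_or_lt_of_le hm.1 with h0m | h0m
      · rwa [← h0m]
      · have hcl : m ∈ closure (Ico 0 m) := by rw [closure_Ico h0m.ne]; exact ⟨h0m.le, le_rfl⟩
        have hcw : ContinuousWithinAt f (Ico 0 m) m :=
          (hf m hm).mono fun t ht => ⟨ht.1, ht.2.le.trans hm.2⟩
        exact hcw.closure_le hcl continuousWithinAt_const hbelow
    have := h m hm fun t ht => by
      rcases eq_or_lt_of_le ht.2 with rfl | h2
      · exact hmle
      · exact hbelow t ⟨ht.1, h2⟩
    exact absurd hmB (not_le.2 (this.trans_lt hcB))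
  exact fun t ht => h t ht fun s hs => (hlt s ⟨hs.1, hs.2.trans ht.2⟩).le

/-- Carathéodory's existence theorem for a globally Lipschitz right-hand side: the Picard operator
on `C([0,T], E)` has a contracting iterate. -/
theorem exists_continuous_eq_add_integral {E : Type*} [NormedAddCommGroup E] [NormedSpace ℝ E]
    [CompleteSpace E] {G : ℝ → E → E} {T : ℝ} (hT : 0 ≤ T) (L : NNReal)
    (hint : ∀ y : ℝ → E, Continuous y → IntervalIntegrable (fun t => G t (y t)) volume 0 T)
    (hlip : ∀ᵐ t ∂(volume.restrict (Icc 0 T)), LipschitzWith L (G t)) (y₀ : E) :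
    ∃ y : ℝ → E, Continuous y ∧ ∀ t ∈ Icc 0 T, y t = y₀ + ∫ s in (0 : ℝ)..t, G s (y s) := by
  let ext (y : C(Icc 0 T, E)) : ℝ → E := IccExtend hT y
  have hext : ∀ y, Continuous (ext y) := fun y => y.continuous.Icc_extend'
  let P : C(Icc 0 T, E) → C(Icc 0 T, E) := fun y =>
    ⟨fun t => y₀ + ∫ s in (0 : ℝ)..t, G s (ext y s), by
      have h1 : ContinuousOn (fun t => ∫ s in (0 : ℝ)..t, G s (ext y s)) (Icc 0 T) := by
        have := intervalIntegral.continuousOn_primitive_interval'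
          (hint _ (hext y)) (a := 0) (by simp)
        rwa [uIcc_of_le hT] at this
      exact continuous_const.add (continuousOn_iff_continuous_domRestrict.1 h1)⟩
  have hPapp : ∀ y (t : Icc 0 T), P y t = y₀ + ∫ s in (0 : ℝ)..t, G s (ext y s) := fun _ _ => rfl
  have hsub : ∀ t : Icc (0 : ℝ) T, uIcc 0 (t : ℝ) ⊆ uIcc 0 T := fun t => by
    rw [uIcc_of_le t.2.1, uIcc_of_le hT]; exact Icc_subset_Icc_right t.2.2
  -- the classical bound `(L t)^k / k!` for the Lipschitz constant of the `k`-th iterate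
  have hiter : ∀ (k : ℕ) (y z : C(Icc 0 T, E)) (t : Icc (0 : ℝ) T),
      dist (P^[k] y t) (P^[k] z t) ≤ (L * t) ^ k / k.factorial * dist y z := by
    intro k y z
    induction k with
    | zero => intro t; simpa using ContinuousMap.dist_apply_le_dist t
    | succ k ih =>
      intro t
      rw [Function.iterate_succ_apply', Function.iterate_succ_apply', hPapp, hPapp,
        dist_add_left, dist_eq_norm, ← intervalIntegral.integral_sub
          ((hint _ (hext _)).mono_set (hsub t)) ((hint _ (hext _)).mono_set (hsub t))]
      have hle : ‖∫ s in (0 : ℝ)..t, (G s (ext (P^[k] y) s) - G s (ext (P^[k] z) s))‖ ≤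
          ∫ s in (0 : ℝ)..t, L * ((L * s) ^ k / k.factorial * dist y z) := by
        refine intervalIntegral.norm_integral_le_of_norm_le t.2.1 ?_
          (Continuous.intervalIntegrable (by fun_prop) _ _)
        filter_upwards [(ae_restrict_iff' measurableSet_Icc).1 hlip] with s hs hst
        have hs' : s ∈ Icc 0 T := ⟨hst.1.le, hst.2.trans t.2.2⟩
        rw [← dist_eq_norm]
        refine ((hs hs').dist_le_mul _ _).trans (mul_le_mul_of_nonneg_left ?_ L.2)
        simpa only [ext, IccExtend_of_mem hT _ hs'] using ih ⟨s, hs'⟩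
      refine hle.trans (le_of_eq ?_)
      have : (fun s : ℝ => (L : ℝ) * ((L * s) ^ k / k.factorial * dist y z)) =
          fun s : ℝ => ((L : ℝ) ^ (k + 1) / k.factorial * dist y z) * s ^ k := by
        funext s; rw [mul_pow]; ring
      rw [this, intervalIntegral.integral_const_mul, integral_pow, Nat.factorial_succ]
      push_cast
      field_simp
      simp only [zero_pow (Nat.succ_ne_zero k), sub_zero]
      ring
  obtain ⟨k, hk⟩ : ∃ k : ℕ, (L * T) ^ k / k.factorial < 1 / 2 :=
    ((FloorSemiring.tendsto_pow_div_factorial_atTop (L * T : ℝ)).eventually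
      (gt_mem_nhds (by norm_num))).exists
  have hcontr : ContractingWith (1 / 2) P^[k] := by
    refine ⟨by norm_num, LipschitzWith.of_dist_le_mul fun y z => ?_⟩
    rw [ContinuousMap.dist_le (by positivity)]
    intro t
    refine (hiter k y z t).trans (mul_le_mul_of_nonneg_right ?_ dist_nonneg)
    refine le_trans ?_ (hk.le.trans (by norm_num))
    have : (L * t : ℝ) ≤ L * T := mul_le_mul_of_nonneg_left t.2.2 L.2
    have h0 : (0 : ℝ) ≤ L * t := mul_nonneg L.2 t.2.1
    gcongr
  have hfix := hcontr.isFixedPt_fixedPoint_iterate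
  set y := hcontr.fixedPoint P^[k]
  refine ⟨ext y, hext y, fun t ht => ?_⟩
  have h1 := congrArg (fun z : C(Icc 0 T, E) => z ⟨t, ht⟩) hfix.eq
  simp only [hPapp] at h1
  rw [h1]
  exact IccExtend_of_mem hT _ ht

/-! ### Dependence of a smooth flow on the initial point -/

section Flow

variable {E : Type*} [NormedAddCommGroup E] [NormedSpace ℝ E]

/-- The initial points from which an integral curve of the autonomous field `H` exists on
`[0,1]`. -/
def flowDomain (H : E → E) : Set E :=
  {p | ∃ γ : ℝ → E, γ 0 = p ∧ IsIntegralCurveOn γ (fun _ => H) (Icc 0 1)}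

open Classical in
/-- An integral curve of `H` on `[0,1]` issuing from `p` (constant if there is none). -/
def trajectory (H : E → E) (p : E) : ℝ → E :=
  if h : p ∈ flowDomain H then h.choose else fun _ => p

open Classical in
/-- The derivative of the flow of `H` at `p`, defined as the solution `W` of the variational
equation `W' = DH(γ) W`, `W(0) = 1`, along the trajectory `γ` of `p` (zero if there is none). -/
def variation (H : E → E) (p : E) : ℝ → E →L[ℝ] E :=
  if h : ∃ W : ℝ → E →L[ℝ] E, W 0 = 1 ∧ ∀ s ∈ Icc (0 : ℝ) 1,
    HasDerivWithinAt W ((fderiv ℝ H (trajectory H p s)).comp (W s)) (Icc 0 1) s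
  then h.choose else 0

variable {H : E → E}

theorem trajectory_zero (p : E) : trajectory H p 0 = p := by
  unfold trajectory
  split_ifs with h
  · exact h.choose_spec.1
  · rfl

theorem trajectory_hasDerivWithinAt {p : E} (hp : p ∈ flowDomain H) :
    ∀ s ∈ Icc (0 : ℝ) 1, HasDerivWithinAt (trajectory H p) (H (trajectory H p s)) (Icc 0 1) s := by
  unfold trajectory
  rw [dif_pos hp]
  exact hp.choose_spec.2

theorem trajectory_continuousOn {p : E} (hp : p ∈ flowDomain H) :
    ContinuousOn (trajectory H p) (Icc 0 1) :=
  fun s hs => (trajectory_hasDerivWithinAt hp s hs).continuousWithinAt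

theorem exists_forall_norm_le_of_continuousOn {F : Type*} [SeminormedAddCommGroup F] {γ : ℝ → F}
    {a b : ℝ} (hγ : ContinuousOn γ (Icc a b)) : ∃ R, 0 ≤ R ∧ ∀ s ∈ Icc a b, ‖γ s‖ ≤ R := by
  obtain ⟨R, hR⟩ := isCompact_Icc.exists_bound_of_continuousOn hγ
  exact ⟨max R 0, le_max_right _ _, fun s hs => (hR s hs).trans (le_max_left _ _)⟩

theorem variation_spec [CompleteSpace E] (hH : ContDiff ℝ 1 H) {p : E} (hp : p ∈ flowDomain H) :
    variation H p 0 = 1 ∧ ∀ s ∈ Icc (0 : ℝ) 1, HasDerivWithinAt (variation H p)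
      ((fderiv ℝ H (trajectory H p s)).comp (variation H p s)) (Icc 0 1) s := by
  have hex : ∃ W : ℝ → E →L[ℝ] E, W 0 = 1 ∧ ∀ s ∈ Icc (0 : ℝ) 1,
      HasDerivWithinAt W ((fderiv ℝ H (trajectory H p s)).comp (W s)) (Icc 0 1) s := by
    have hA : ContinuousOn (fun s => fderiv ℝ H (trajectory H p s)) (Icc 0 1) :=
      (hH.continuous_fderiv one_ne_zero).comp_continuousOn (trajectory_continuousOn hp)
    set A : ℝ → E →L[ℝ] E :=
      IccExtend zero_le_one ((Icc 0 1).domRestrict fun s => fderiv ℝ H (trajectory H p s))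
      with hAdef
    have hAc : Continuous A := (continuousOn_iff_continuous_domRestrict.1 hA).Icc_extend'
    have hAeq : ∀ s ∈ Icc (0 : ℝ) 1, A s = fderiv ℝ H (trajectory H p s) := fun s hs => by
      rw [hAdef, IccExtend_of_mem zero_le_one _ hs]; rfl
    obtain ⟨C, hC0, hC⟩ := exists_forall_norm_le_of_continuousOn (hAc.continuousOn (s := Icc 0 1))
    obtain ⟨W, hWc, hW⟩ := exists_continuous_eq_add_integral (G := fun t X => (A t).comp X)
      zero_le_one ⟨C, hC0⟩
      (fun y hy => (hAc.clm_comp hy).intervalIntegrable _ _)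
      ((ae_restrict_iff' measurableSet_Icc).2 (Eventually.of_forall fun t ht =>
        LipschitzWith.of_dist_le_mul fun X Y => by
          rw [dist_eq_norm, dist_eq_norm, ← ContinuousLinearMap.comp_sub]
          exact (ContinuousLinearMap.opNorm_comp_le _ _).trans
            (mul_le_mul_of_nonneg_right (hC t ht) (norm_nonneg _)))) (1 : E →L[ℝ] E)
    refine ⟨W, by simpa using hW 0 (by simp), fun s hs => ?_⟩
    have hc : Continuous fun t => (A t).comp (W t) := hAc.clm_comp hWc
    have hd := ((intervalIntegral.integral_hasDerivAt_right (hc.intervalIntegrable 0 s)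
      (hc.stronglyMeasurableAtFilter _ _) hc.continuousAt).const_add (1 : E →L[ℝ] E))
    rw [← hAeq s hs]
    exact hd.hasDerivWithinAt.congr hW (hW s hs)
  unfold variation
  rw [dif_pos hex]
  exact hex.choose_spec

/-- Quadratic estimate of the remainder in the first order expansion of a `C^2` map. -/
theorem norm_sub_sub_fderiv_le (hH : ContDiff ℝ 2 H) {R K : ℝ}
    (hK : ∀ x y : E, ‖x‖ ≤ R → ‖y‖ ≤ R → ‖fderiv ℝ H x - fderiv ℝ H y‖ ≤ K * ‖x - y‖)
    (hK0 : 0 ≤ K) {x y : E} (hx : ‖x‖ ≤ R) (hy : ‖y‖ ≤ R) :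
    ‖H x - H y - fderiv ℝ H y (x - y)‖ ≤ K * ‖x - y‖ ^ 2 := by
  have hseg : segment ℝ y x ⊆ Metric.closedBall 0 R :=
    (convex_closedBall (0 : E) R).segment_subset (by simpa using hy) (by simpa using hx)
  have := (convex_segment y x).norm_image_sub_le_of_norm_fderiv_le' (f := H) (φ := fderiv ℝ H y)
    (C := K * ‖x - y‖) (𝕜 := ℝ)
    (fun w _ => (hH.differentiable two_ne_zero).differentiableAt)
    (fun w hw => by
      refine (hK w y (by simpa using hseg hw) hy).trans (mul_le_mul_of_nonneg_left ?_ hK0)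
      rw [segment_eq_image'] at hw
      obtain ⟨θ, hθ, rfl⟩ := hw
      simp only [add_sub_cancel_left, norm_smul, Real.norm_eq_abs, abs_of_nonneg hθ.1]
      exact mul_le_of_le_one_left (norm_nonneg _) hθ.2)
    (left_mem_segment ℝ y x) (right_mem_segment ℝ y x)
  rw [pow_two, ← mul_assoc]
  exact this

variable [FiniteDimensional ℝ E]

/-- A `C^1` map is Lipschitz on every ball. -/
theorem exists_lipschitzOnWith_closedBall {F : Type*} [NormedAddCommGroup F] [NormedSpace ℝ F]
    {Φ : E → F} (hΦ : ContDiff ℝ 1 Φ) (R : ℝ) :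
    ∃ K : ℝ, 0 ≤ K ∧ ∀ x y : E, ‖x‖ ≤ R → ‖y‖ ≤ R → ‖Φ x - Φ y‖ ≤ K * ‖x - y‖ := by
  have := FiniteDimensional.proper ℝ E
  obtain ⟨K, hK⟩ := (hΦ.contDiffOn (s := Metric.closedBall 0 R)).exists_lipschitzOnWith one_ne_zero
    (convex_closedBall _ _) (isCompact_closedBall _ _)
  refine ⟨K, K.2, fun x y hx hy => ?_⟩
  rw [← dist_eq_norm, ← dist_eq_norm]
  exact hK.dist_le_mul x (by simpa using hx) y (by simpa using hy)

/-- Uniqueness of integral curves of a `C^1` field. -/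
theorem integralCurve_eqOn (hH : ContDiff ℝ 1 H) {γ γ' : ℝ → E}
    (hγ : IsIntegralCurveOn γ (fun _ => H) (Icc 0 1))
    (hγ' : IsIntegralCurveOn γ' (fun _ => H) (Icc 0 1)) (h0 : γ 0 = γ' 0) :
    EqOn γ γ' (Icc 0 1) := by
  obtain ⟨R, -, hR⟩ := exists_forall_norm_le_of_continuousOn hγ.continuousOn
  obtain ⟨R', -, hR'⟩ := exists_forall_norm_le_of_continuousOn hγ'.continuousOn
  obtain ⟨K, hK0, hK⟩ := exists_lipschitzOnWith_closedBall hH (max R R')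
  intro s hs
  have := norm_le_mul_exp_of_norm_deriv_le le_rfl hK0 le_rfl le_rfl
    (fun t ht => (hγ t ht).sub (hγ' t ht)) (by simp [h0])
    (fun t ht => by
      simpa using hK _ _ ((hR t ht).trans (le_max_left _ _)) ((hR' t ht).trans (le_max_right _ _)))
    s hs
  simpa [sub_eq_zero] using this

theorem eqOn_trajectory (hH : ContDiff ℝ 1 H) {γ : ℝ → E}
    (hγ : IsIntegralCurveOn γ (fun _ => H) (Icc 0 1)) :
    EqOn γ (trajectory H (γ 0)) (Icc 0 1) :=
  integralCurve_eqOn hH hγ (trajectory_hasDerivWithinAt ⟨γ, rfl, hγ⟩) (trajectory_zero _).symm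

/-- Near each point of its domain, and relative to it, the time-one flow of a `C^2` field is
Lipschitz, has the solution of the variational equation as its derivative, with a quadratic
remainder, and this derivative is Lipschitz. -/
theorem exists_flow_estimates (hH : ContDiff ℝ 2 H) {p₀ : E} (hp₀ : p₀ ∈ flowDomain H) :
    ∃ r > 0, ∃ K : ℝ, 0 ≤ K ∧ ∀ p ∈ flowDomain H ∩ Metric.ball p₀ r,
      ∀ q ∈ flowDomain H ∩ Metric.ball p₀ r,
      ‖trajectory H p 1 - trajectory H q 1‖ ≤ K * ‖p - q‖ ∧
      ‖trajectory H p 1 - trajectory H q 1 - variation H q 1 (p - q)‖ ≤ K * ‖p - q‖ ^ 2 ∧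
      ‖variation H p 1 - variation H q 1‖ ≤ K * ‖p - q‖ := by
  have hH1 : ContDiff ℝ 1 H := hH.of_le one_le_two
  obtain ⟨R, hR0, hR⟩ := exists_forall_norm_le_of_continuousOn (trajectory_continuousOn hp₀)
  obtain ⟨L, hL0, hL⟩ := exists_lipschitzOnWith_closedBall hH1 (R + 1)
  obtain ⟨L', hL'0, hL'⟩ := exists_lipschitzOnWith_closedBall (Φ := fderiv ℝ H)
    (hH.fderiv_right (m := 1) (by norm_num)) (R + 1)
  set C := ‖fderiv ℝ H 0‖ + L' * (R + 1) with hCdef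
  have hC0 : 0 ≤ C := by positivity
  have hC : ∀ x : E, ‖x‖ ≤ R + 1 → ‖fderiv ℝ H x‖ ≤ C := fun x hx => by
    have h1 := hL' x 0 hx (by simp; positivity)
    have h2 := norm_sub_norm_le (fderiv ℝ H x) (fderiv ℝ H 0)
    rw [sub_zero] at h1
    have h3 : L' * ‖x‖ ≤ L' * (R + 1) := mul_le_mul_of_nonneg_left hx hL'0
    linarith
  -- with this radius Gronwall's inequality bounds the deviation from the trajectory of `p₀` by
  -- `1/2` as long as it is at most `1`, which is what continuous induction requires
  set r := Real.exp (-L) / 2 with hr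
  -- trajectories issuing from the ball of radius `r` stay within distance one of that of `p₀`
  have hstay : ∀ p ∈ flowDomain H ∩ Metric.ball p₀ r, ∀ s ∈ Icc (0 : ℝ) 1,
      ‖trajectory H p s‖ ≤ R + 1 := by
    rintro p ⟨hp, hpr⟩
    rw [Metric.mem_ball, dist_eq_norm] at hpr
    have hsmall : ‖p - p₀‖ * Real.exp L ≤ 1 / 2 := by
      have := mul_le_mul_of_nonneg_right hpr.le (Real.exp_pos L).le
      rwa [hr, div_mul_eq_mul_div, ← Real.exp_add, neg_add_cancel, Real.exp_zero] at this
    have hone : ‖p - p₀‖ ≤ 1 := by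
      have := Real.one_le_exp hL0
      nlinarith [norm_nonneg (p - p₀)]
    have hclose := forall_le_of_forall_improve (T := 1) (c := 1 / 2) (B := 1)
      (f := fun s => ‖trajectory H p s - trajectory H p₀ s‖)
      ((trajectory_continuousOn hp).sub (trajectory_continuousOn hp₀)).norm (by norm_num)
      (by simpa [trajectory_zero] using hone)
      (fun S hS hbd => by
        have hsub : ∀ t ∈ Icc 0 S, t ∈ Icc (0 : ℝ) 1 := fun t ht => ⟨ht.1, ht.2.trans hS.2⟩
        refine le_trans (norm_le_mul_exp_of_norm_deriv_le (norm_nonneg (p - p₀)) hL0 le_rfl hS.2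
          (fun t ht => (trajectory_hasDerivWithinAt hp t (hsub t ht)).sub
            (trajectory_hasDerivWithinAt hp₀ t (hsub t ht)))
          (by simp [trajectory_zero]) (fun t ht => ?_) S ⟨hS.1, le_rfl⟩) (by simpa using hsmall)
        have h1 := hR t (hsub t ht)
        have h2 := norm_le_norm_add_norm_sub' (trajectory H p t) (trajectory H p₀ t)
        simpa using hL _ _ (by linarith [hbd t ht]) (by linarith))
    intro s hs
    have h1 := hR s hs
    have h2 := norm_le_norm_add_norm_sub' (trajectory H p s) (trajectory H p₀ s)
    have h3 := hclose s hs
    linarith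
  have hlip : ∀ p ∈ flowDomain H ∩ Metric.ball p₀ r, ∀ q ∈ flowDomain H ∩ Metric.ball p₀ r,
      ∀ s ∈ Icc (0 : ℝ) 1, ‖trajectory H p s - trajectory H q s‖ ≤ ‖p - q‖ * Real.exp L := by
    intro p hp q hq s hs
    simpa using norm_le_mul_exp_of_norm_deriv_le (norm_nonneg (p - q)) hL0 le_rfl le_rfl
      (fun t ht => (trajectory_hasDerivWithinAt hp.1 t ht).sub
        (trajectory_hasDerivWithinAt hq.1 t ht)) (by simp [trajectory_zero])
      (fun t ht => by simpa using hL _ _ (hstay p hp t ht) (hstay q hq t ht)) s hs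
  have hWbd : ∀ q ∈ flowDomain H ∩ Metric.ball p₀ r, ∀ s ∈ Icc (0 : ℝ) 1,
      ‖variation H q s‖ ≤ Real.exp C := by
    intro q hq s hs
    obtain ⟨hW0, hW⟩ := variation_spec hH1 hq.1
    simpa using norm_le_mul_exp_of_norm_deriv_le zero_le_one hC0 le_rfl le_rfl hW
      (by rw [hW0]; exact ContinuousLinearMap.norm_id_le)
      (fun t ht => by
        rw [add_zero]
        exact (ContinuousLinearMap.opNorm_comp_le _ _).trans
          (mul_le_mul_of_nonneg_right (hC _ (hstay q hq t ht)) (norm_nonneg _))) s hs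
  have hone : (1 : ℝ) ∈ Icc (0 : ℝ) 1 := ⟨zero_le_one, le_rfl⟩
  set K₁ := Real.exp L
  set K₂ := L' * Real.exp L ^ 2 * Real.exp C
  set K₃ := L' * Real.exp L * Real.exp C * Real.exp C
  have hK₁ : 0 ≤ K₁ := (Real.exp_pos L).le
  have hK₂ : 0 ≤ K₂ := by positivity
  have hK₃ : 0 ≤ K₃ := by positivity
  refine ⟨r, by positivity, K₁ + K₂ + K₃, by positivity, fun p hp q hq => ⟨?_, ?_, ?_⟩⟩
  · refine (hlip p hp q hq 1 hone).trans ?_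
    rw [mul_comm]
    exact mul_le_mul_of_nonneg_right (by linarith) (norm_nonneg _)
  · -- the remainder solves the variational equation up to a quadratic error
    obtain ⟨hW0, hW⟩ := variation_spec hH1 hq.1
    have key := norm_le_mul_exp_of_norm_deriv_le (S := 1) le_rfl hC0
      (show 0 ≤ L' * (‖p - q‖ * Real.exp L) ^ 2 by positivity) le_rfl
      (fun t ht => ((trajectory_hasDerivWithinAt hp.1 t ht).sub
        (trajectory_hasDerivWithinAt hq.1 t ht)).sub
          ((hW t ht).clm_apply (hasDerivWithinAt_const t _ (p - q))))
      (by simp [trajectory_zero, hW0])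
      (fun t ht => by
        have hpt := hstay p hp t ht
        have hqt := hstay q hq t ht
        have h1 := norm_sub_sub_fderiv_le hH hL' hL'0 hpt hqt
        have h2 := (fderiv ℝ H (trajectory H q t)).le_of_opNorm_le (hC _ hqt)
          (trajectory H p t - trajectory H q t - variation H q t (p - q))
        have h3 : L' * ‖trajectory H p t - trajectory H q t‖ ^ 2 ≤
            L' * (‖p - q‖ * Real.exp L) ^ 2 :=
          mul_le_mul_of_nonneg_left
            (pow_le_pow_left₀ (norm_nonneg _) (hlip p hp q hq t ht) 2) hL'0
        refine le_trans (le_of_eq ?_) ((norm_add_le _ _).trans (add_le_add h2 (h1.trans h3)))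
        congr 1
        simp only [map_zero, add_zero, ContinuousLinearMap.comp_apply, map_sub]
        abel) 1 hone
    refine key.trans (le_of_eq_of_le ?_ (mul_le_mul_of_nonneg_right
      (show K₂ ≤ K₁ + K₂ + K₃ by linarith) (sq_nonneg _)))
    simp only [K₂]
    ring
  · obtain ⟨hWp0, hWp⟩ := variation_spec hH1 hp.1
    obtain ⟨hWq0, hWq⟩ := variation_spec hH1 hq.1
    have key := norm_le_mul_exp_of_norm_deriv_le (S := 1) le_rfl hC0
      (show 0 ≤ L' * (‖p - q‖ * Real.exp L) * Real.exp C by positivity) le_rfl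
      (fun t ht => (hWp t ht).sub (hWq t ht)) (by simp [hWp0, hWq0])
      (fun t ht => by
        have hpt := hstay p hp t ht
        have hqt := hstay q hq t ht
        have h1 : ‖(fderiv ℝ H (trajectory H p t)).comp (variation H p t - variation H q t)‖ ≤
            C * ‖variation H p t - variation H q t‖ :=
          (ContinuousLinearMap.opNorm_comp_le _ _).trans
            (mul_le_mul_of_nonneg_right (hC _ hpt) (norm_nonneg _))
        have h2 : ‖(fderiv ℝ H (trajectory H p t) - fderiv ℝ H (trajectory H q t)).comp
            (variation H q t)‖ ≤ L' * (‖p - q‖ * Real.exp L) * Real.exp C :=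
          (ContinuousLinearMap.opNorm_comp_le _ _).trans
            (mul_le_mul ((hL' _ _ hpt hqt).trans
              (mul_le_mul_of_nonneg_left (hlip p hp q hq t ht) hL'0)) (hWbd q hq t ht)
              (norm_nonneg _) (by positivity))
        refine le_trans (le_of_eq ?_) ((norm_add_le _ _).trans (add_le_add h1 h2))
        congr 1
        simp only [ContinuousLinearMap.comp_sub, ContinuousLinearMap.sub_comp]
        abel) 1 hone
    refine key.trans (le_of_eq_of_le ?_ (mul_le_mul_of_nonneg_right
      (show K₃ ≤ K₁ + K₂ + K₃ by linarith) (norm_nonneg _)))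
    simp only [K₃]
    ring

end Flow

section

section Flow

variable {E F G : Type*} [NormedAddCommGroup E] [NormedSpace ℝ E] [FiniteDimensional ℝ E]
  [NormedAddCommGroup F] [NormedSpace ℝ F] [NormedAddCommGroup G] [NormedSpace ℝ G] {H : E → E}

/-- The estimates of `exists_flow_estimates` in linear coordinates: `ι` parametrizes initial points
and `π` observes the final one. -/
theorem exists_comp_flow_estimates (hH : ContDiff ℝ 2 H) (ι : F →L[ℝ] E) (π : E →L[ℝ] G) {S : Set F}
    (hS : MapsTo ι S (flowDomain H)) {p₀ : F} (hp₀ : p₀ ∈ S) :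
    ∃ V ∈ 𝓝[S] p₀, V ⊆ S ∧ ∃ K : ℝ, 0 ≤ K ∧ ∀ p ∈ V, ∀ q ∈ V,
      ‖π (trajectory H (ι p) 1) - π (trajectory H (ι q) 1)‖ ≤ K * ‖p - q‖ ∧
      ‖π (trajectory H (ι p) 1) - π (trajectory H (ι q) 1) -
        (π.comp ((variation H (ι q) 1).comp ι)) (p - q)‖ ≤ K * ‖p - q‖ ^ 2 ∧
      ‖π.comp ((variation H (ι p) 1).comp ι) - π.comp ((variation H (ι q) 1).comp ι)‖ ≤
        K * ‖p - q‖ := by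
  obtain ⟨r, hr, K, hK, h⟩ := exists_flow_estimates hH (hS hp₀)
  refine ⟨S ∩ ι ⁻¹' Metric.ball (ι p₀) r, inter_mem self_mem_nhdsWithin (mem_nhdsWithin_of_mem_nhds
    (ι.continuous.continuousAt (Metric.ball_mem_nhds _ hr))), inter_subset_left,
    ‖π‖ * (K * ‖ι‖) + ‖π‖ * (K * ‖ι‖ ^ 2), by positivity,
    fun p hp q hq => ?_⟩
  obtain ⟨h1, h2, h3⟩ := h (ι p) ⟨hS hp.1, hp.2⟩ (ι q) ⟨hS hq.1, hq.2⟩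
  have hι : ‖ι p - ι q‖ ≤ ‖ι‖ * ‖p - q‖ := by rw [← map_sub]; exact ι.le_opNorm _
  have a1 : 0 ≤ ‖π‖ * (K * ‖ι‖) := by positivity
  have a2 : 0 ≤ ‖π‖ * (K * ‖ι‖ ^ 2) := by positivity
  refine ⟨?_, ?_, ?_⟩
  · rw [← map_sub]
    calc _ ≤ ‖π‖ * (K * (‖ι‖ * ‖p - q‖)) :=
          (π.le_opNorm _).trans (by gcongr; exact h1.trans (by gcongr))
      _ = ‖π‖ * (K * ‖ι‖) * ‖p - q‖ := by ring
      _ ≤ _ := by gcongr; linarith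
  · rw [ContinuousLinearMap.comp_apply, ContinuousLinearMap.comp_apply, map_sub ι, ← map_sub,
      ← map_sub]
    calc _ ≤ ‖π‖ * (K * (‖ι‖ * ‖p - q‖) ^ 2) :=
          (π.le_opNorm _).trans (by gcongr; exact h2.trans (by gcongr))
      _ = ‖π‖ * (K * ‖ι‖ ^ 2) * ‖p - q‖ ^ 2 := by ring
      _ ≤ _ := by gcongr; linarith
  · rw [← ContinuousLinearMap.comp_sub, ← ContinuousLinearMap.sub_comp]
    calc _ ≤ ‖π‖ * ((K * (‖ι‖ * ‖p - q‖)) * ‖ι‖) := by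
          refine (ContinuousLinearMap.opNorm_comp_le _ _).trans ?_
          gcongr
          refine (ContinuousLinearMap.opNorm_comp_le _ _).trans ?_
          gcongr
          exact h3.trans (by gcongr)
      _ = ‖π‖ * (K * ‖ι‖ ^ 2) * ‖p - q‖ := by ring
      _ ≤ _ := by gcongr; linarith

theorem locallyLipschitzOn_comp_trajectory (hH : ContDiff ℝ 2 H) (ι : F →L[ℝ] E) (π : E →L[ℝ] G)
    {S : Set F} (hS : MapsTo ι S (flowDomain H)) :
    LocallyLipschitzOn S fun p => π (trajectory H (ι p) 1) := by
  intro p₀ hp₀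
  obtain ⟨V, hV, -, K, hK, h⟩ := exists_comp_flow_estimates hH ι π hS hp₀
  refine ⟨⟨K, hK⟩, V, hV, LipschitzOnWith.of_dist_le_mul fun p hp q hq => ?_⟩
  rw [dist_eq_norm, dist_eq_norm]
  exact (h p hp q hq).1

theorem locallyLipschitzOn_comp_variation (hH : ContDiff ℝ 2 H) (ι : F →L[ℝ] E) (π : E →L[ℝ] G)
    {S : Set F} (hS : MapsTo ι S (flowDomain H)) :
    LocallyLipschitzOn S fun p => π.comp ((variation H (ι p) 1).comp ι) := by
  intro p₀ hp₀
  obtain ⟨V, hV, -, K, hK, h⟩ := exists_comp_flow_estimates hH ι π hS hp₀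
  refine ⟨⟨K, hK⟩, V, hV, LipschitzOnWith.of_dist_le_mul fun p hp q hq => ?_⟩
  rw [dist_eq_norm, dist_eq_norm]
  exact (h p hp q hq).2.2

theorem hasFDerivWithinAt_comp_trajectory (hH : ContDiff ℝ 2 H) (ι : F →L[ℝ] E) (π : E →L[ℝ] G)
    {S : Set F} (hS : MapsTo ι S (flowDomain H)) {q : F} (hq : q ∈ S) :
    HasFDerivWithinAt (fun p => π (trajectory H (ι p) 1))
      (π.comp ((variation H (ι q) 1).comp ι)) S q := by
  obtain ⟨V, hV, hVS, K, hK, h⟩ := exists_comp_flow_estimates hH ι π hS hq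
  have hqV : q ∈ V := mem_of_mem_nhdsWithin hq hV
  refine HasFDerivWithinAt.of_isLittleO ?_
  refine Asymptotics.IsBigO.trans_isLittleO (g := fun p => ‖p - q‖ ^ 2) ?_ ?_
  · refine Asymptotics.IsBigO.of_bound K ?_
    filter_upwards [hV] with p hp
    rw [Real.norm_of_nonneg (sq_nonneg _)]
    exact (h p hp q hqV).2.1
  · refine (Asymptotics.IsLittleO.mono ?_ nhdsWithin_le_nhds)
    exact Asymptotics.isLittleO_norm_pow_id (one_lt_two) |>.comp_tendsto
      (tendsto_sub_nhds_zero_iff.2 tendsto_id)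

end Flow

/-! ### The straightening diffeomorphism -/

variable {n m l : ℕ}

theorem combG_snd (g : Fin m → Vec n × Vec m → Vec n) (c : Vec m) (p : Vec n × Vec m) :
    (combG g c p).2 = c := by
  simp only [combG, augG, Prod.snd_sum, Prod.smul_snd]
  ext i
  simp [Pi.single_apply]

theorem combG_neg (g : Fin m → Vec n × Vec m → Vec n) (c : Vec m) (p : Vec n × Vec m) :
    combG g (-c) p = -combG g c p := by
  simp [combG]

theorem augG_contDiff {g : Fin m → Vec n × Vec m → Vec n} (hg : ∀ α, ContDiff ℝ 2 (g α))
    (α : Fin m) : ContDiff ℝ 2 (augG g α) :=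
  (hg α).prodMk contDiff_const

theorem combG_contDiff {g : Fin m → Vec n × Vec m → Vec n} (hg : ∀ α, ContDiff ℝ 2 (g α))
    (c : Vec m) : ContDiff ℝ 2 (combG g c) :=
  ContDiff.sum fun k _ => (augG_contDiff hg k).const_smul (c k)

/-- The field `(p, c) ↦ (∑_k c^k g_k(p), 0)`: the coefficients of the combination become part of the
state, so that the exponential is the time-one flow of a single field. -/
def stateField (g : Fin m → Vec n × Vec m → Vec n) (q : (Vec n × Vec m) × Vec m) :
    (Vec n × Vec m) × Vec m :=
  (combG g q.2 q.1, 0)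

theorem stateField_contDiff {g : Fin m → Vec n × Vec m → Vec n} (hg : ∀ α, ContDiff ℝ 2 (g α)) :
    ContDiff ℝ 2 (stateField g) := by
  refine ContDiff.prodMk (ContDiff.sum fun k _ => ContDiff.fun_smul ?_ ?_) contDiff_const
  · exact (EuclideanSpace.proj (𝕜 := ℝ) k).contDiff.comp contDiff_snd
  · exact (augG_contDiff hg k).comp contDiff_fst

theorem fderiv_combG {g : Fin m → Vec n × Vec m → Vec n} (hg : ∀ α, ContDiff ℝ 2 (g α))
    (c : Vec m) (p v : Vec n × Vec m) :
    fderiv ℝ (combG g c) p v = ∑ k, c k • fderiv ℝ (augG g k) p v := by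
  have h : HasFDerivAt (combG g c) (∑ k, c k • fderiv ℝ (augG g k) p) p := by
    refine HasFDerivAt.fun_sum fun k _ => ?_
    exact ((augG_contDiff hg k).differentiable
      two_ne_zero).differentiableAt.hasFDerivAt.const_smul (c k)
  rw [h.fderiv]
  simp

theorem fderiv_stateField {g : Fin m → Vec n × Vec m → Vec n} (hg : ∀ α, ContDiff ℝ 2 (g α))
    (p v : Vec n × Vec m) (c w : Vec m) :
    fderiv ℝ (stateField g) (p, c) (v, w) = (fderiv ℝ (combG g c) p v + combG g w p, 0) := by
  have h1 (k : Fin m) : HasFDerivAt (fun q : (Vec n × Vec m) × Vec m => q.2 k)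
      ((EuclideanSpace.proj (𝕜 := ℝ) k).comp (ContinuousLinearMap.snd ℝ (Vec n × Vec m) (Vec m)))
      (p, c) :=
    (EuclideanSpace.proj (𝕜 := ℝ) k).hasFDerivAt.comp (p, c) hasFDerivAt_snd
  have h2 (k : Fin m) : HasFDerivAt (fun q : (Vec n × Vec m) × Vec m => augG g k q.1)
      ((fderiv ℝ (augG g k) p).comp (ContinuousLinearMap.fst ℝ (Vec n × Vec m) (Vec m)))
      (p, c) := by
    have h3 : HasFDerivAt (augG g k) (fderiv ℝ (augG g k) p) p :=
      ((augG_contDiff hg k).differentiable two_ne_zero).differentiableAt.hasFDerivAt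
    exact HasFDerivAt.comp (g := augG g k) (p, c) h3 hasFDerivAt_fst
  have h : HasFDerivAt (stateField g) _ (p, c) :=
    (HasFDerivAt.fun_sum (u := Finset.univ) fun k _ => (h1 k).fun_smul (h2 k)).prodMk
      (hasFDerivAt_const (0 : Vec m) (p, c))
  rw [h.fderiv, fderiv_combG hg]
  simp [combG, Finset.sum_add_distrib]

theorem fderiv_combG_comm {g : Fin m → Vec n × Vec m → Vec n} (hg : ∀ α, ContDiff ℝ 2 (g α))
    {p : Vec n × Vec m} (hp : ∀ α β, VectorField.lieBracket ℝ (augG g α) (augG g β) p = 0)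
    (b c : Vec m) :
    fderiv ℝ (combG g b) p (combG g c p) = fderiv ℝ (combG g c) p (combG g b p) := by
  rw [fderiv_combG hg, fderiv_combG hg]
  simp only [combG, map_sum, map_smul, Finset.smul_sum]
  rw [Finset.sum_comm]
  refine Finset.sum_congr rfl fun β _ => Finset.sum_congr rfl fun α _ => ?_
  have := hp β α
  rw [VectorField.lieBracket, sub_eq_zero] at this
  rw [this, smul_comm]

theorem IsFlowLine.expG_eq {g : Fin m → Vec n × Vec m → Vec n} (hg : ∀ α, ContDiff ℝ 2 (g α))
    {c : Vec m} {p : Vec n × Vec m} {γ : ℝ → Vec n × Vec m} (h : IsFlowLine g c p γ) :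
    expG g c p = γ 1 := by
  have hex : ∃ γ, IsFlowLine g c p γ := ⟨γ, h⟩
  unfold expG
  rw [dif_pos hex]
  exact integralCurve_eqOn ((combG_contDiff hg c).of_le one_le_two) hex.choose_spec.2 h.2
    (hex.choose_spec.1.trans h.1.symm) ⟨zero_le_one, le_rfl⟩

theorem IsFlowLine.snd_eq {g : Fin m → Vec n × Vec m → Vec n}
    {c : Vec m} {p : Vec n × Vec m} {γ : ℝ → Vec n × Vec m} (h : IsFlowLine g c p γ) :
    ∀ s ∈ Icc (0 : ℝ) 1, (γ s).2 = p.2 + s • c := by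
  intro s hs
  have hd : ∀ t ∈ Icc (0 : ℝ) 1, HasDerivWithinAt (fun s => (γ s).2 - (p.2 + s • c)) 0
      (Icc 0 1) t := fun t ht => by
    have h1 : HasDerivWithinAt (fun s => (γ s).2) c (Icc 0 1) t := by
      have := (ContinuousLinearMap.snd ℝ (Vec n) (Vec m)).hasFDerivAt.comp_hasDerivWithinAt t
        (h.2 t ht)
      simpa [combG_snd, Function.comp_def] using this
    have h2 := ((hasDerivWithinAt_id t (Icc (0 : ℝ) 1)).smul_const c).const_add p.2
    simpa using h1.fun_sub h2
  have := norm_le_mul_exp_of_norm_deriv_le (δ := 0) (K := 0) (ε := 0) le_rfl le_rfl le_rfl le_rfl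
    hd (by simp [h.1]) (by simp) s hs
  simpa [sub_eq_zero] using this

theorem IsFlowLine.reverse {g : Fin m → Vec n × Vec m → Vec n}
    {c : Vec m} {p : Vec n × Vec m} {γ : ℝ → Vec n × Vec m} (h : IsFlowLine g c p γ) :
    IsFlowLine g (-c) (γ 1) fun s => γ (1 - s) := by
  refine ⟨by simp, fun s hs => ?_⟩
  have hmem : 1 - s ∈ Icc (0 : ℝ) 1 := ⟨by linarith [hs.2], by linarith [hs.1]⟩
  have h1 := (h.2 (1 - s) hmem).scomp s ((hasDerivWithinAt_id s (Icc (0 : ℝ) 1)).const_sub 1)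
    (fun t ht => ⟨by simpa using ht.2, by simpa using ht.1⟩)
  change HasDerivWithinAt _ (combG g (-c) (γ (1 - s))) _ _
  rw [combG_neg]
  simpa [Function.comp_def] using h1

theorem IsFlowLine.stateCurve {g : Fin m → Vec n × Vec m → Vec n}
    {c : Vec m} {p : Vec n × Vec m} {γ : ℝ → Vec n × Vec m} (h : IsFlowLine g c p γ) :
    IsIntegralCurveOn (fun s => (γ s, c)) (fun _ => stateField g) (Icc 0 1) :=
  fun s hs => (h.2 s hs).prodMk (hasDerivWithinAt_const _ _ _)

theorem IsFlowLine.mem_flowDomain {g : Fin m → Vec n × Vec m → Vec n}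
    {c : Vec m} {p : Vec n × Vec m} {γ : ℝ → Vec n × Vec m} (h : IsFlowLine g c p γ) :
    (p, c) ∈ flowDomain (stateField g) :=
  ⟨_, by rw [h.1], h.stateCurve⟩

theorem IsFlowLine.trajectory_eq {g : Fin m → Vec n × Vec m → Vec n}
    (hg : ∀ α, ContDiff ℝ 2 (g α))
    {c : Vec m} {p : Vec n × Vec m} {γ : ℝ → Vec n × Vec m} (h : IsFlowLine g c p γ) :
    ∀ s ∈ Icc (0 : ℝ) 1, trajectory (stateField g) (p, c) s = (γ s, c) := by
  intro s hs
  have := eqOn_trajectory ((stateField_contDiff hg).of_le one_le_two) h.stateCurve hs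
  rw [this, h.1]

/-- The first component of `exp(∑_k z^k g_k)(ξ, 0)`, which inverts `straighten` over each `z`. -/
def unstraighten (g : Fin m → Vec n × Vec m → Vec n) (q : Vec n × Vec m) : Vec n :=
  (expG g q.2 (q.1, 0)).1

section Straighten

variable {g : Fin m → Vec n × Vec m → Vec n} {U : Set (Vec m)}

theorem expG_neg_eq (hg : FieldAssumption g U) {p : Vec n × Vec m} (hp : p.2 ∈ U) :
    expG g (-p.2) p = (straighten g p, 0) := by
  obtain ⟨γ, hγ⟩ := hg.flow p.1 p.2 hp
  have h1 := hγ.expG_eq hg.smooth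
  have h2 := hγ.snd_eq 1 ⟨zero_le_one, le_rfl⟩
  refine Prod.ext rfl ?_
  change (expG g (-p.2) (p.1, p.2)).2 = 0
  rw [h1, h2]
  simp

theorem expG_zero_eq (hg : FieldAssumption g U) {q : Vec n × Vec m} (hq : q.2 ∈ U) :
    expG g q.2 (q.1, 0) = (unstraighten g q, q.2) := by
  obtain ⟨γ, hγ⟩ := hg.flow_inv q.1 q.2 hq
  have h1 := hγ.expG_eq hg.smooth
  have h2 := hγ.snd_eq 1 ⟨zero_le_one, le_rfl⟩
  refine Prod.ext rfl ?_
  rw [h1, h2]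
  simp

theorem unstraighten_straighten (hg : FieldAssumption g U) (x : Vec n) {z : Vec m} (hz : z ∈ U) :
    unstraighten g (straighten g (x, z), z) = x := by
  obtain ⟨γ, hγ⟩ := hg.flow x z hz
  have h1 : γ 1 = (straighten g (x, z), 0) := by
    rw [← hγ.expG_eq hg.smooth]; exact expG_neg_eq hg (p := (x, z)) hz
  have h2 := hγ.reverse
  rw [neg_neg, h1] at h2
  have h3 := h2.expG_eq hg.smooth
  simp only [sub_self, hγ.1] at h3
  simp [unstraighten, h3]

theorem straighten_unstraighten (hg : FieldAssumption g U) (ξ : Vec n) {z : Vec m} (hz : z ∈ U) :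
    straighten g (unstraighten g (ξ, z), z) = ξ := by
  obtain ⟨γ, hγ⟩ := hg.flow_inv ξ z hz
  have h1 : γ 1 = (unstraighten g (ξ, z), z) := by
    rw [← hγ.expG_eq hg.smooth]; exact expG_zero_eq hg (q := (ξ, z)) hz
  have h2 := hγ.reverse
  rw [h1] at h2
  have h3 := h2.expG_eq hg.smooth
  simp only [sub_self, hγ.1] at h3
  simp [straighten, h3]

theorem bijOn_coordChange (hg : FieldAssumption g U) :
    BijOn (coordChange g) (univ ×ˢ U) (univ ×ˢ U) := by
  refine ⟨fun p hp => ⟨mem_univ _, hp.2⟩, fun p hp q hq h => ?_, fun q hq => ?_⟩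
  · change coordChange g p = coordChange g q at h
    have h2 : p.2 = q.2 := (Prod.ext_iff.1 h).2
    have h1 : straighten g p = straighten g q := (Prod.ext_iff.1 h).1
    refine Prod.ext ?_ h2
    have e1 := unstraighten_straighten hg p.1 hp.2
    have e2 := unstraighten_straighten hg q.1 hq.2
    rw [← e1, ← e2, Prod.mk.eta, Prod.mk.eta, h1, h2]
  · exact ⟨(unstraighten g q, q.2), ⟨mem_univ _, hq.2⟩,
      Prod.ext (straighten_unstraighten hg q.1 hq.2) rfl⟩

theorem coordChangeInv_eq (hg : FieldAssumption g U) {q : Vec n × Vec m} (hq : q.2 ∈ U) :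
    coordChangeInv g U q = (unstraighten g q, q.2) := by
  have hb := bijOn_coordChange hg
  have h1 : coordChange g (unstraighten g q, q.2) = q :=
    Prod.ext (straighten_unstraighten hg q.1 hq) rfl
  have h2 := hb.invOn_invFunOn.1 (show (unstraighten g q, q.2) ∈ univ ×ˢ U from ⟨mem_univ _, hq⟩)
  rw [h1] at h2
  exact h2

/-- The initial state `((x,z),-z)` of the flow defining `straighten`. -/
def straightenInit (n m : ℕ) : Vec n × Vec m →L[ℝ] (Vec n × Vec m) × Vec m :=
  (ContinuousLinearMap.id ℝ _).prod (-ContinuousLinearMap.snd ℝ _ _)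

/-- The initial state `((ξ,0),z)` of the flow defining `unstraighten`. -/
def unstraightenInit (n m : ℕ) : Vec n × Vec m →L[ℝ] (Vec n × Vec m) × Vec m :=
  ((ContinuousLinearMap.fst ℝ _ _).prod 0).prod (ContinuousLinearMap.snd ℝ _ _)

/-- The projection of a state `((x,z),c)` to `x`. -/
def stateFst (n m : ℕ) : (Vec n × Vec m) × Vec m →L[ℝ] Vec n :=
  (ContinuousLinearMap.fst ℝ _ _).comp (ContinuousLinearMap.fst ℝ _ _)

/-- The derivative of `straighten`. -/
def straightenDeriv (g : Fin m → Vec n × Vec m → Vec n) (p : Vec n × Vec m) :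
    Vec n × Vec m →L[ℝ] Vec n :=
  (stateFst n m).comp
    ((variation (stateField g) (straightenInit n m p) 1).comp (straightenInit n m))

/-- The derivative of `unstraighten`. -/
def unstraightenDeriv (g : Fin m → Vec n × Vec m → Vec n) (p : Vec n × Vec m) :
    Vec n × Vec m →L[ℝ] Vec n :=
  (stateFst n m).comp
    ((variation (stateField g) (unstraightenInit n m p) 1).comp (unstraightenInit n m))

theorem mapsTo_straightenInit (hg : FieldAssumption g U) :
    MapsTo (straightenInit n m) (univ ×ˢ U) (flowDomain (stateField g)) := fun p hp => by
  obtain ⟨γ, hγ⟩ := hg.flow p.1 p.2 hp.2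
  exact hγ.mem_flowDomain

theorem mapsTo_unstraightenInit (hg : FieldAssumption g U) :
    MapsTo (unstraightenInit n m) (univ ×ˢ U) (flowDomain (stateField g)) := fun p hp => by
  obtain ⟨γ, hγ⟩ := hg.flow_inv p.1 p.2 hp.2
  exact hγ.mem_flowDomain

theorem straighten_eqOn (hg : FieldAssumption g U) :
    EqOn (straighten g) (fun p => stateFst n m (trajectory (stateField g) (straightenInit n m p) 1))
      (univ ×ˢ U) := fun p hp => by
  obtain ⟨γ, hγ⟩ := hg.flow p.1 p.2 hp.2
  have h1 := hγ.expG_eq hg.smooth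
  have h2 := hγ.trajectory_eq hg.smooth 1 ⟨zero_le_one, le_rfl⟩
  change (expG g (-p.2) (p.1, p.2)).1 = (trajectory (stateField g) ((p.1, p.2), -p.2) 1).1.1
  rw [h1, h2]

theorem unstraighten_eqOn (hg : FieldAssumption g U) :
    EqOn (unstraighten g)
      (fun p => stateFst n m (trajectory (stateField g) (unstraightenInit n m p) 1))
      (univ ×ˢ U) := fun p hp => by
  obtain ⟨γ, hγ⟩ := hg.flow_inv p.1 p.2 hp.2
  have h1 := hγ.expG_eq hg.smooth
  have h2 := hγ.trajectory_eq hg.smooth 1 ⟨zero_le_one, le_rfl⟩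
  change (expG g p.2 (p.1, 0)).1 = (trajectory (stateField g) ((p.1, 0), p.2) 1).1.1
  rw [h1, h2]

theorem _root_.LocallyLipschitzOn.congr {α β : Type*} [PseudoEMetricSpace α] [PseudoEMetricSpace β]
    {f f' : α → β} {s : Set α} (h : LocallyLipschitzOn s f) (hf : EqOn f' f s) :
    LocallyLipschitzOn s f' := fun x hx => by
  obtain ⟨K, t, ht, hK⟩ := h hx
  refine ⟨K, t ∩ s, inter_mem ht self_mem_nhdsWithin, fun a ha b hb => ?_⟩
  rw [hf ha.2, hf hb.2]
  exact hK ha.1 hb.1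

theorem straighten_locallyLipschitzOn (hg : FieldAssumption g U) :
    LocallyLipschitzOn (univ ×ˢ U) (straighten g) :=
  (locallyLipschitzOn_comp_trajectory (stateField_contDiff hg.smooth) _ _
    (mapsTo_straightenInit hg)).congr (straighten_eqOn hg)

theorem unstraighten_locallyLipschitzOn (hg : FieldAssumption g U) :
    LocallyLipschitzOn (univ ×ˢ U) (unstraighten g) :=
  (locallyLipschitzOn_comp_trajectory (stateField_contDiff hg.smooth) _ _
    (mapsTo_unstraightenInit hg)).congr (unstraighten_eqOn hg)

theorem straightenDeriv_locallyLipschitzOn (hg : FieldAssumption g U) :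
    LocallyLipschitzOn (univ ×ˢ U) (straightenDeriv g) :=
  locallyLipschitzOn_comp_variation (stateField_contDiff hg.smooth) _ _ (mapsTo_straightenInit hg)

theorem hasFDerivWithinAt_straighten (hg : FieldAssumption g U) {p : Vec n × Vec m}
    (hp : p.2 ∈ U) : HasFDerivWithinAt (straighten g) (straightenDeriv g p) (univ ×ˢ U) p :=
  have hp' : p ∈ (univ : Set (Vec n)) ×ˢ U := ⟨mem_univ _, hp⟩
  (hasFDerivWithinAt_comp_trajectory (stateField_contDiff hg.smooth) _ _
    (mapsTo_straightenInit hg) hp').congr (straighten_eqOn hg) (straighten_eqOn hg hp')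

theorem hasFDerivWithinAt_unstraighten (hg : FieldAssumption g U) {p : Vec n × Vec m}
    (hp : p.2 ∈ U) : HasFDerivWithinAt (unstraighten g) (unstraightenDeriv g p) (univ ×ˢ U) p :=
  have hp' : p ∈ (univ : Set (Vec n)) ×ˢ U := ⟨mem_univ _, hp⟩
  (hasFDerivWithinAt_comp_trajectory (stateField_contDiff hg.smooth) _ _
    (mapsTo_unstraightenInit hg) hp').congr (unstraighten_eqOn hg) (unstraighten_eqOn hg hp')

/-- A derivative within `ℝ^n × U` restricts to a derivative in the direction of `ℝ^n`. -/
theorem hasFDerivAt_slice {Φ : Vec n × Vec m → Vec n} {D : Vec n × Vec m →L[ℝ] Vec n}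
    {x : Vec n} {z : Vec m} (hz : z ∈ U) (h : HasFDerivWithinAt Φ D (univ ×ˢ U) (x, z)) :
    HasFDerivAt (fun x => Φ (x, z)) (D.comp (ContinuousLinearMap.inl ℝ _ _)) x := by
  rw [← hasFDerivWithinAt_univ]
  exact h.comp x (hasFDerivAt_prodMk_left x z).hasFDerivWithinAt
    fun y _ => mk_mem_prod (mem_univ y) hz

theorem fderiv_straighten (hg : FieldAssumption g U) {p : Vec n × Vec m} (hp : p.2 ∈ U) :
    fderiv ℝ (fun x => straighten g (x, p.2)) p.1 =
      (straightenDeriv g p).comp (ContinuousLinearMap.inl ℝ _ _) :=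
  (hasFDerivAt_slice hp (hasFDerivWithinAt_straighten hg (p := (p.1, p.2)) hp)).fderiv

theorem unstraightenDeriv_straightenDeriv (hg : FieldAssumption g U) (x : Vec n) {z : Vec m}
    (hz : z ∈ U) (v : Vec n) :
    unstraightenDeriv g (straighten g (x, z), z) (straightenDeriv g (x, z) (v, 0), 0) = v := by
  have h1 := hasFDerivAt_slice hz (hasFDerivWithinAt_straighten hg (p := (x, z)) hz)
  have h2 := hasFDerivAt_slice hz
    (hasFDerivWithinAt_unstraighten hg (p := (straighten g (x, z), z)) hz)
  have h3 := h2.comp x h1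
  have h4 : HasFDerivAt (fun x : Vec n => x) _ x :=
    h3.congr_of_eventuallyEq
      (Eventually.of_forall fun y => (unstraighten_straighten hg y hz).symm)
  simpa using DFunLike.congr_fun (h4.unique (hasFDerivAt_id x)) v

theorem straightenDeriv_unstraightenDeriv (hg : FieldAssumption g U) (ξ : Vec n) {z : Vec m}
    (hz : z ∈ U) (v : Vec n) :
    straightenDeriv g (unstraighten g (ξ, z), z) (unstraightenDeriv g (ξ, z) (v, 0), 0) = v := by
  have h1 := hasFDerivAt_slice hz (hasFDerivWithinAt_unstraighten hg (p := (ξ, z)) hz)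
  have h2 := hasFDerivAt_slice hz
    (hasFDerivWithinAt_straighten hg (p := (unstraighten g (ξ, z), z)) hz)
  have h3 := h2.comp ξ h1
  have h4 : HasFDerivAt (fun x : Vec n => x) _ ξ :=
    h3.congr_of_eventuallyEq
      (Eventually.of_forall fun y => (straighten_unstraighten hg y hz).symm)
  simpa using DFunLike.congr_fun (h4.unique (hasFDerivAt_id ξ)) v

/-- Since the fields commute, moving the parameter `z` in the direction `ζ` moves the end point
of the flow line of `∑_k z^k g_k` along `∑_k ζ^k g_k`: the variational equation along the flow line
`γ` has the explicit solution `s ↦ (s ∑_k ζ^k g_k(γ(s)), ζ)`. -/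
theorem unstraightenDeriv_snd (hg : FieldAssumption g U) (ξ : Vec n) {z : Vec m}
    (hz : z ∈ U) (ζ : Vec m) :
    unstraightenDeriv g (ξ, z) (0, ζ) = (combG g ζ (unstraighten g (ξ, z), z)).1 := by
  obtain ⟨γ, hγ⟩ := hg.flow_inv ξ z hz
  have hH := (stateField_contDiff hg.smooth).of_le one_le_two
  obtain ⟨hW0, hW⟩ := variation_spec hH hγ.mem_flowDomain
  set W := variation (stateField g) ((ξ, 0), z)
  -- the flow line runs over the points `s z`, where the fields commute
  have hbr : ∀ s ∈ Icc (0 : ℝ) 1, ∀ α β,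
      VectorField.lieBracket ℝ (augG g α) (augG g β) (γ s) = 0 := fun s hs α β => by
    have h1 := hg.commute α β (γ s).1 z hz s hs
    have h2 := hγ.snd_eq s hs
    simp only [zero_add] at h2
    rwa [← h2] at h1
  have hv : ∀ s ∈ Icc (0 : ℝ) 1, HasDerivWithinAt (fun s => (s • combG g ζ (γ s), ζ))
      (fderiv ℝ (stateField g) (γ s, z) (s • combG g ζ (γ s), ζ)) (Icc 0 1) s := fun s hs => by
    have h1 : HasDerivWithinAt (fun s => combG g ζ (γ s))
        (fderiv ℝ (combG g ζ) (γ s) (combG g z (γ s))) (Icc 0 1) s :=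
      (((combG_contDiff hg.smooth ζ).differentiable two_ne_zero).differentiableAt
        (x := γ s)).hasFDerivAt.comp_hasDerivWithinAt s (hγ.2 s hs)
    have h2 := ((hasDerivWithinAt_id s (Icc (0 : ℝ) 1)).smul h1).prodMk
      (hasDerivWithinAt_const s (Icc (0 : ℝ) 1) ζ)
    rw [fderiv_stateField hg.smooth, map_smul, ← fderiv_combG_comm hg.smooth (hbr s hs)]
    simpa using h2
  -- both sides solve the same linear equation with the same initial value
  obtain ⟨C, hC0, hC⟩ := exists_forall_norm_le_of_continuousOn
    ((hH.continuous_fderiv one_ne_zero).comp_continuousOn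
      (hγ.stateCurve.continuousOn))
  have key := norm_le_mul_exp_of_norm_deriv_le (δ := 0) (ε := 0) (S := 1) le_rfl hC0 le_rfl le_rfl
    (fun s hs => ((hW s hs).clm_apply (hasDerivWithinAt_const s _
      ((0, ζ) : (Vec n × Vec m) × Vec m))).sub (hv s hs)) (by simp [hW0])
    (fun s hs => by
      rw [hγ.trajectory_eq hg.smooth s hs]
      simp only [map_zero, add_zero, ContinuousLinearMap.comp_apply]
      rw [← map_sub]
      exact (ContinuousLinearMap.le_opNorm _ _).trans
        (mul_le_mul_of_nonneg_right (hC s hs) (norm_nonneg _))) 1 ⟨zero_le_one, le_rfl⟩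
  have key' : W 1 (0, ζ) = ((1 : ℝ) • combG g ζ (γ 1), ζ) := by
    simpa [sub_eq_zero] using key
  have h1 : γ 1 = (unstraighten g (ξ, z), z) := by
    rw [← hγ.expG_eq hg.smooth]; exact expG_zero_eq hg (q := (ξ, z)) hz
  rw [h1] at key'
  change (W 1 ((0, 0), ζ)).1.1 = _
  rw [show (((0, 0), ζ) : (Vec n × Vec m) × Vec m) = (0, ζ) from rfl, key']
  simp

end Straighten

end

section

/-! ### The transformed drift -/

variable {n m l : ℕ} {f : Vec n × Vec m → Vec l → Vec n} {g : Fin m → Vec n × Vec m → Vec n}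
  {U : Set (Vec m)} {A : Set (Vec l)}

/-- The points of `ℝ^n × U` in the closed ball of radius `r`. -/
def boundedCylinder (n : ℕ) {m : ℕ} (U : Set (Vec m)) (r : ℝ) : Set (Vec n × Vec m) :=
  Metric.closedBall 0 r ∩ univ ×ˢ U

theorem isCompact_boundedCylinder (hU : IsClosed U) (r : ℝ) :
    IsCompact (boundedCylinder n U r) :=
  (isCompact_closedBall _ _).inter_right (isClosed_univ.prod hU)

theorem boundedCylinder_subset (r : ℝ) : boundedCylinder n U r ⊆ univ ×ˢ U := inter_subset_right

theorem _root_.LocallyLipschitzOn.exists_norm_sub_le {E F : Type*} [SeminormedAddCommGroup E]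
    [SeminormedAddCommGroup F] {Φ : E → F} {S K : Set E} (h : LocallyLipschitzOn S Φ)
    (hK : IsCompact K) (hKS : K ⊆ S) :
    ∃ L : ℝ, 0 ≤ L ∧ ∀ p ∈ K, ∀ q ∈ K, ‖Φ p - Φ q‖ ≤ L * ‖p - q‖ := by
  obtain ⟨L, hL⟩ := (h.mono hKS).exists_lipschitzOnWith_of_compact hK
  refine ⟨L, L.2, fun p hp q hq => ?_⟩
  rw [← dist_eq_norm, ← dist_eq_norm]
  exact hL.dist_le_mul p hp q hq

/-- The drift is Lipschitz on compact sets, uniformly in the control: on the compact set `A` it is a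
locally Lipschitz map into `C(A, ℝ^n)`. -/
theorem DriftAssumption.exists_lipschitz (hf : DriftAssumption f U A) (hA : IsCompact A)
    {K : Set (Vec n × Vec m)} (hK : IsCompact K) (hKU : K ⊆ univ ×ˢ U) :
    ∃ L : ℝ, 0 ≤ L ∧ ∀ a ∈ A, ∀ p ∈ K, ∀ q ∈ K, ‖f p a - f q a‖ ≤ L * ‖p - q‖ := by
  classical
  have : CompactSpace A := isCompact_iff_compactSpace.1 hA
  let Φ : Vec n × Vec m → C(A, Vec n) := fun p =>
    if hp : p ∈ (univ : Set (Vec n)) ×ˢ U then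
      ⟨A.domRestrict (f p), continuousOn_iff_continuous_domRestrict.1 (hf.continuous p hp)⟩ else 0
  have hΦ : ∀ p ∈ (univ : Set (Vec n)) ×ˢ U, ∀ a : A, Φ p a = f p a := fun p hp a => by
    simp only [Φ, dif_pos hp]; rfl
  have hloc : LocallyLipschitzOn (univ ×ˢ U) Φ := fun p hp => by
    obtain ⟨L, V, hV, hL⟩ := hf.lipschitz p hp
    refine ⟨L, V ∩ univ ×ˢ U, inter_mem hV self_mem_nhdsWithin,
      LipschitzOnWith.of_dist_le_mul fun x hx y hy => ?_⟩
    rw [ContinuousMap.dist_le (by positivity)]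
    intro a
    rw [hΦ x hx.2, hΦ y hy.2]
    exact (hL a a.2).dist_le_mul x hx.1 y hy.1
  obtain ⟨L, hL0, hL⟩ := hloc.exists_norm_sub_le hK hKU
  refine ⟨L, hL0, fun a ha p hp q hq => ?_⟩
  rw [← hΦ p (hKU hp) ⟨a, ha⟩, ← hΦ q (hKU hq) ⟨a, ha⟩]
  exact ((Φ p - Φ q).norm_coe_le_norm ⟨a, ha⟩).trans (hL p hp q hq)

theorem DriftAssumption.exists_bound (hf : DriftAssumption f U A) {K : Set (Vec n × Vec m)}
    (hK : IsCompact K) (hKU : K ⊆ univ ×ˢ U) :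
    ∃ C : ℝ, 0 ≤ C ∧ ∀ a ∈ A, ∀ p ∈ K, ‖f p a‖ ≤ C := by
  obtain ⟨M, hM, h⟩ := hf.growth
  obtain ⟨R, hR⟩ := hK.isBounded.exists_norm_le
  refine ⟨M * (1 + max R 0), by positivity, fun a ha p hp => (h p (hKU hp) a ha).trans ?_⟩
  gcongr
  exact (hR p hp).trans (le_max_left _ _)

/-- The inverse change of coordinates is Lipschitz on bounded sets. -/
theorem exists_norm_unstraighten_sub_le (hU : IsClosed U) (hg : FieldAssumption g U) (r : ℝ) :
    ∃ L : ℝ, 0 ≤ L ∧ ∀ p ∈ boundedCylinder n U r, ∀ q ∈ boundedCylinder n U r,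
      ‖(unstraighten g p, p.2) - (unstraighten g q, q.2)‖ ≤ L * ‖p - q‖ := by
  obtain ⟨L, hL, h⟩ := (unstraighten_locallyLipschitzOn hg).exists_norm_sub_le
    (isCompact_boundedCylinder (n := n) hU r) (boundedCylinder_subset r)
  refine ⟨L + 1, by positivity, fun p hp q hq => ?_⟩
  have h2 : ‖p.2 - q.2‖ ≤ ‖p - q‖ := norm_snd_le (p - q)
  refine max_le ((h p hp q hq).trans ?_) (h2.trans ?_) <;> nlinarith [norm_nonneg (p - q)]

/-- Over `U`, the transformed drift is `∂φ/∂x · f̃` at the preimage `(ψ(ξ,η),η)`. -/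
theorem transF_eq (hg : FieldAssumption g U) {q : Vec n × Vec m} (hq : q.2 ∈ U) (a : Vec l) :
    transF f g U q a = straightenDeriv g (unstraighten g q, q.2)
      (f (unstraighten g q, q.2) a, 0) := by
  have h := fderiv_straighten hg (p := (unstraighten g q, q.2)) hq
  simp only [transF, coordChangeInv_eq hg hq]
  rw [h]
  rfl

/-- The transformed drift is Lipschitz and bounded on bounded sets, uniformly in the control. -/
theorem exists_transF_estimates (hU : IsClosed U) (hA : IsCompact A) (hf : DriftAssumption f U A)
    (hg : FieldAssumption g U) (r : ℝ) :
    ∃ L : ℝ, 0 ≤ L ∧ ∃ C : ℝ, 0 ≤ C ∧ ∀ a ∈ A, ∀ p ∈ boundedCylinder n U r,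
      ‖transF f g U p a‖ ≤ C ∧
      ∀ q ∈ boundedCylinder n U r, ‖transF f g U p a - transF f g U q a‖ ≤ L * ‖p - q‖ := by
  have hK := isCompact_boundedCylinder (n := n) hU r
  have hKS := boundedCylinder_subset (n := n) (U := U) r
  obtain ⟨L₁, hL₁, hΨL⟩ := exists_norm_unstraighten_sub_le (n := n) hU hg r
  set Ψ : Vec n × Vec m → Vec n × Vec m := fun q => (unstraighten g q, q.2) with hΨ
  have hΨc : ContinuousOn Ψ (boundedCylinder n U r) :=
    ((unstraighten_locallyLipschitzOn hg).continuousOn.mono hKS).prodMk continuousOn_snd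
  have hK' := hK.image_of_continuousOn hΨc
  have hKS' : Ψ '' boundedCylinder n U r ⊆ univ ×ˢ U := by
    rintro _ ⟨q, hq, rfl⟩
    exact ⟨mem_univ _, (hKS hq).2⟩
  obtain ⟨L₂, hL₂, h₂⟩ := hf.exists_lipschitz hA hK' hKS'
  obtain ⟨C₂, hC₂, hb₂⟩ := hf.exists_bound hK' hKS'
  obtain ⟨L₃, hL₃, h₃⟩ := (straightenDeriv_locallyLipschitzOn hg).exists_norm_sub_le hK' hKS'
  obtain ⟨C₃', hb₃'⟩ := hK'.exists_bound_of_continuousOn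
    ((straightenDeriv_locallyLipschitzOn hg).continuousOn.mono hKS')
  set C₃ := max C₃' 0
  have hC₃ : 0 ≤ C₃ := le_max_right _ _
  have hb₃ : ∀ p ∈ Ψ '' boundedCylinder n U r, ‖straightenDeriv g p‖ ≤ C₃ := fun p hp =>
    (hb₃' p hp).trans (le_max_left _ _)
  have hnorm : ∀ v : Vec n, ‖((v, 0) : Vec n × Vec m)‖ = ‖v‖ := fun v => by simp [Prod.norm_def]
  refine ⟨L₃ * L₁ * C₂ + C₃ * (L₂ * L₁), by positivity, C₃ * C₂, by positivity,
    fun a ha p hp => ⟨?_, fun q hq => ?_⟩⟩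
  · rw [transF_eq hg (hKS hp).2]
    have hp' := mem_image_of_mem Ψ hp
    refine (ContinuousLinearMap.le_opNorm _ _).trans ?_
    rw [hnorm]
    exact mul_le_mul (hb₃ _ hp') (hb₂ a ha _ hp') (norm_nonneg _) hC₃
  · rw [transF_eq hg (hKS hp).2, transF_eq hg (hKS hq).2]
    have hp' := mem_image_of_mem Ψ hp
    have hq' := mem_image_of_mem Ψ hq
    have hpq := hΨL p hp q hq
    have e1 : ‖(straightenDeriv g (Ψ p) - straightenDeriv g (Ψ q)) (f (Ψ p) a, 0)‖ ≤
        L₃ * (L₁ * ‖p - q‖) * C₂ := by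
      refine (ContinuousLinearMap.le_opNorm _ _).trans ?_
      rw [hnorm]
      exact mul_le_mul ((h₃ _ hp' _ hq').trans (by gcongr)) (hb₂ a ha _ hp') (norm_nonneg _)
        (by positivity)
    have e2 : ‖straightenDeriv g (Ψ q) (f (Ψ p) a - f (Ψ q) a, 0)‖ ≤
        C₃ * (L₂ * (L₁ * ‖p - q‖)) := by
      refine (ContinuousLinearMap.le_opNorm _ _).trans ?_
      rw [hnorm]
      exact mul_le_mul (hb₃ _ hq') ((h₂ a ha _ hp' _ hq').trans (by gcongr)) (norm_nonneg _) hC₃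
    have e3 : straightenDeriv g (Ψ p) (f (Ψ p) a, 0) - straightenDeriv g (Ψ q) (f (Ψ q) a, 0) =
        (straightenDeriv g (Ψ p) - straightenDeriv g (Ψ q)) (f (Ψ p) a, 0) +
          straightenDeriv g (Ψ q) (f (Ψ p) a - f (Ψ q) a, 0) := by
      have : ((f (Ψ p) a - f (Ψ q) a, 0) : Vec n × Vec m) = (f (Ψ p) a, 0) - (f (Ψ q) a, 0) := by
        simp
      rw [this, map_sub, sub_apply]
      abel
    change ‖straightenDeriv g (Ψ p) (f (Ψ p) a, 0) - straightenDeriv g (Ψ q) (f (Ψ q) a, 0)‖ ≤ _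
    rw [e3]
    refine (norm_add_le _ _).trans ((add_le_add e1 e2).trans (le_of_eq ?_))
    ring

theorem transF_continuousOn (hf : DriftAssumption f U A) (hg : FieldAssumption g U)
    {q : Vec n × Vec m} (hq : q.2 ∈ U) : ContinuousOn (transF f g U q) A := by
  have h : transF f g U q = fun a => straightenDeriv g (unstraighten g q, q.2)
      (f (unstraighten g q, q.2) a, 0) := funext fun a => transF_eq hg hq a
  rw [h]
  exact (straightenDeriv g _).continuous.comp_continuousOn
    ((hf.continuous (unstraighten g q, q.2) ⟨mem_univ _, hq⟩).prodMk continuousOn_const)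

/-- Composing a Carathéodory-type function with measurable arguments. -/
theorem aestronglyMeasurable_comp₂ {E F G : Type*} [NormedAddCommGroup E] [MeasurableSpace E]
    [BorelSpace E] [SecondCountableTopology E] [NormedAddCommGroup F] [MeasurableSpace F]
    [BorelSpace F] [SecondCountableTopology F] [NormedAddCommGroup G]
    {μ : Measure ℝ} {Φ : E → F → G} {K : Set E} {A : Set F} {L : ℝ} (hK : IsClosed K)
    (hA : IsClosed A)
    (hL : ∀ a ∈ A, ∀ p ∈ K, ∀ q ∈ K, ‖Φ p a - Φ q a‖ ≤ L * ‖p - q‖)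
    (hc : ∀ p ∈ K, ContinuousOn (Φ p) A) {q : ℝ → E} {a : ℝ → F}
    (hq : AEStronglyMeasurable q μ) (ha : AEStronglyMeasurable a μ)
    (hqK : ∀ᵐ t ∂μ, q t ∈ K) (haA : ∀ᵐ t ∂μ, a t ∈ A) :
    AEStronglyMeasurable (fun t => Φ (q t) (a t)) μ := by
  have hcont : ContinuousOn (Function.uncurry Φ) (K ×ˢ A) := by
    refine continuousOn_prod_of_continuousOn_lipschitzOnWith _ (Real.toNNReal L) hc fun a ha => ?_
    refine LipschitzOnWith.of_dist_le_mul fun p hp q hq => ?_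
    rw [dist_eq_norm, dist_eq_norm]
    exact (hL a ha p hp q hq).trans
      (mul_le_mul_of_nonneg_right (Real.le_coe_toNNReal L) (norm_nonneg _))
  have hmeas : MeasurableSet (K ×ˢ A) := (hK.prod hA).measurableSet
  have hpair : AEMeasurable (fun t => (q t, a t)) μ := hq.aemeasurable.prodMk ha.aemeasurable
  have hmem : ∀ᵐ t ∂μ, (q t, a t) ∈ K ×ˢ A := by
    filter_upwards [hqK, haA] with t h1 h2 using ⟨h1, h2⟩
  have h1 : AEStronglyMeasurable (Function.uncurry Φ) (Measure.map (fun t => (q t, a t)) μ) := by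
    have h2 := hcont.aestronglyMeasurable (μ := Measure.map (fun t => (q t, a t)) μ) hmeas
    have h3 : ∀ᵐ p ∂(Measure.map (fun t => (q t, a t)) μ), p ∈ K ×ˢ A :=
      (ae_map_iff hpair hmeas).2 hmem
    rwa [Measure.restrict_eq_self_of_ae_mem h3] at h2
  exact h1.comp_aemeasurable hpair

end

section

/-! ### Absolutely continuous solutions -/

section AC

variable {X Y Z : Type*} [PseudoMetricSpace X] [PseudoMetricSpace Y] [PseudoMetricSpace Z]
  {E : Type*} [NormedAddCommGroup E] [NormedSpace ℝ E]

/-- A function whose increments are controlled by those of absolutely continuous functions is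
absolutely continuous. -/
theorem _root_.AbsolutelyContinuousOnInterval.of_dist_le {h : ℝ → X} {f : ℝ → Y} {g : ℝ → Z}
    {a b C : ℝ} (hf : AbsolutelyContinuousOnInterval f a b)
    (hg : AbsolutelyContinuousOnInterval g a b)
    (hle : ∀ x ∈ uIcc a b, ∀ y ∈ uIcc a b,
      dist (h x) (h y) ≤ C * (dist (f x) (f y) + dist (g x) (g y))) :
    AbsolutelyContinuousOnInterval h a b := by
  unfold AbsolutelyContinuousOnInterval at hf hg ⊢
  have hlim := (Filter.Tendsto.add hf hg).const_mul C
  simp only [add_zero, mul_zero] at hlim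
  refine squeeze_zero' (Eventually.of_forall fun I => Finset.sum_nonneg fun i _ => dist_nonneg)
    ?_ hlim
  refine eventually_inf_principal.2 (Eventually.of_forall fun I hI => ?_)
  rw [← Finset.sum_add_distrib, Finset.mul_sum]
  exact Finset.sum_le_sum fun i hi => hle _ (hI.1 i hi).1 _ (hI.1 i hi).2

theorem _root_.LipschitzOnWith.comp_absolutelyContinuousOnInterval {Φ : Y → X} {f : ℝ → Y}
    {a b : ℝ} {K : NNReal} {s : Set Y} (hΦ : LipschitzOnWith K Φ s)
    (hf : AbsolutelyContinuousOnInterval f a b) (hs : MapsTo f (uIcc a b) s) :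
    AbsolutelyContinuousOnInterval (fun t => Φ (f t)) a b :=
  hf.of_dist_le hf (C := K) fun x hx y hy => by
    have := hΦ.dist_le_mul (f x) (hs hx) (f y) (hs hy)
    have h0 : (0 : ℝ) ≤ K * dist (f x) (f y) := by positivity
    rw [mul_add]
    linarith

theorem _root_.AbsolutelyContinuousOnInterval.prodMk {f : ℝ → Y} {g : ℝ → Z} {a b : ℝ}
    (hf : AbsolutelyContinuousOnInterval f a b) (hg : AbsolutelyContinuousOnInterval g a b) :
    AbsolutelyContinuousOnInterval (fun t => (f t, g t)) a b :=
  hf.of_dist_le hg (C := 1) fun x _ y _ => by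
    rw [one_mul, Prod.dist_eq]
    exact max_le_add_of_nonneg dist_nonneg dist_nonneg

theorem _root_.IntervalIntegrable.absolutelyContinuousOnInterval_integral {k : ℝ → E} {a b : ℝ}
    (hk : IntervalIntegrable k volume a b) :
    AbsolutelyContinuousOnInterval (fun t => ∫ s in a..t, k s) a b := by
  have h1 := hk.norm.absolutelyContinuousOnInterval_intervalIntegral (c := a) (by simp)
  refine h1.of_dist_le h1 (C := 1) fun x hx y hy => ?_
  have hsub : ∀ z ∈ uIcc a b, IntervalIntegrable k volume a z := fun z hz =>
    hk.mono_set (uIcc_subset_uIcc_left hz)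
  have hsub' : ∀ z ∈ uIcc a b, IntervalIntegrable (fun s => ‖k s‖) volume a z := fun z hz =>
    (hsub z hz).norm
  rw [dist_eq_norm, dist_eq_norm,
    intervalIntegral.integral_interval_sub_left (hsub x hx) (hsub y hy),
    intervalIntegral.integral_interval_sub_left (hsub' x hx) (hsub' y hy)]
  have h2 := intervalIntegral.norm_integral_le_abs_integral_norm (f := k) (a := y) (b := x)
    (μ := volume)
  rw [← Real.norm_eq_abs] at h2
  linarith [norm_nonneg (∫ s in y..x, ‖k s‖)]

/-- The fundamental theorem of calculus for absolutely continuous functions with values in a normed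
space whose derivative is known almost everywhere. -/
theorem _root_.AbsolutelyContinuousOnInterval.eq_add_integral [CompleteSpace E] {h k : ℝ → E}
    {S : ℝ} (hS : 0 ≤ S) (hh : AbsolutelyContinuousOnInterval h 0 S)
    (hk : IntervalIntegrable k volume 0 S)
    (hd : ∀ᵐ t, t ∈ Ioo 0 S → HasDerivAt h (k t) t) :
    ∀ t ∈ Icc 0 S, h t = h 0 + ∫ s in (0 : ℝ)..t, k s := by
  have hac := hh.sub hk.absolutelyContinuousOnInterval_integral
  have h0 : ∀ᵐ t : ℝ, t ≠ 0 := by simp [ae_iff, measure_singleton]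
  have h1 : ∀ᵐ t : ℝ, t ≠ S := by simp [ae_iff, measure_singleton]
  obtain ⟨C, hC⟩ := hac.const_of_ae_hasDerivAt_zero (by
    filter_upwards [hd, hk.ae_hasDerivAt_integral, h0, h1] with t ht1 ht2 ht3 ht4 ht
    rw [uIcc_of_le hS] at ht
    have := (ht1 ⟨lt_of_le_of_ne ht.1 (Ne.symm ht3), lt_of_le_of_ne ht.2 ht4⟩).sub
      (ht2 (by rwa [uIcc_of_le hS]) 0 (by simp))
    rwa [sub_self] at this)
  rw [uIcc_of_le hS] at hC
  intro t ht
  have e1 := hC t ht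
  have e2 := hC 0 ⟨le_rfl, hS⟩
  simp only [Pi.sub_apply, intervalIntegral.integral_same, sub_zero] at e1 e2
  rw [e2, ← e1]
  abel

theorem IsACSolution.ae_hasDerivAt [CompleteSpace E] {rhs : ℝ → E → E} {S : ℝ} {y₀ : E}
    {y : ℝ → E} (h : IsACSolution rhs S y₀ y) :
    ∀ᵐ t, t ∈ Ioo 0 S → HasDerivAt y (rhs t (y t)) t := by
  filter_upwards [h.integrable.ae_hasDerivAt_integral] with t ht hts
  have hS : (0 : ℝ) ≤ S := hts.1.le.trans hts.2.le
  have h1 := (ht (by rw [uIcc_of_le hS]; exact Ioo_subset_Icc_self hts) 0 (by simp)).const_add y₀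
  refine h1.congr_of_eventuallyEq ?_
  filter_upwards [Ioo_mem_nhds hts.1 hts.2] with s hs
  exact h.eq s (Ioo_subset_Icc_self hs)

theorem IsACSolution.continuousOn {rhs : ℝ → E → E} {S : ℝ} (hS : 0 ≤ S) {y₀ : E}
    {y : ℝ → E} (h : IsACSolution rhs S y₀ y) : ContinuousOn y (Icc 0 S) := by
  have := h.ac.continuousOn
  rwa [uIcc_of_le hS] at this

theorem IsACSolution.initial {rhs : ℝ → E → E} {S : ℝ} (hS : 0 ≤ S) {y₀ : E}
    {y : ℝ → E} (h : IsACSolution rhs S y₀ y) : y 0 = y₀ := by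
  simpa using h.eq 0 ⟨le_rfl, hS⟩

end AC

/-! ### Smooth controls: the two Cauchy problems are equivalent -/

variable {n m l : ℕ} {f : Vec n × Vec m → Vec l → Vec n} {g : Fin m → Vec n × Vec m → Vec n}
  {U : Set (Vec m)} {A : Set (Vec l)} {T S : ℝ} {w : ℝ → Vec m} {a : ℝ → Vec l} {x₀ : Vec n}

theorem IsC1Control.hasDerivAt (hw : IsC1Control U T w) {t : ℝ} (ht : t ∈ Ioo 0 T) :
    HasDerivAt w (derivWithin w (Icc 0 T) t) t :=
  ((hw.1.differentiableOn one_ne_zero t (Ioo_subset_Icc_self ht)).hasDerivWithinAt).hasDerivAt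
    (Icc_mem_nhds ht.1 ht.2)

theorem IsC1Control.absolutelyContinuous (hw : IsC1Control U T w) (hS : S ∈ Icc 0 T) :
    AbsolutelyContinuousOnInterval w 0 S := by
  refine ContDiffOn.absolutelyContinuousOnInterval (hw.1.mono ?_)
  rw [uIcc_of_le hS.1]
  exact Icc_subset_Icc_right hS.2

theorem IsC1Control.continuousOn (hw : IsC1Control U T w) (hS : S ∈ Icc 0 T) :
    ContinuousOn w (Icc 0 S) :=
  hw.1.continuousOn.mono (Icc_subset_Icc_right hS.2)

theorem IsSmoothSolution.snd_eq {y : ℝ → Vec n × Vec m} (hw : IsC1Control U T w)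
    (hS : S ∈ Icc 0 T) (hy : IsSmoothSolution f g T S x₀ w a y) :
    ∀ t ∈ Icc 0 S, (y t).2 = w t := by
  have hac : AbsolutelyContinuousOnInterval (fun t => (y t).2 - w t) 0 S := by
    have h1 : AbsolutelyContinuousOnInterval (fun t => (y t).2) 0 S :=
      LipschitzWith.prod_snd.lipschitzOnWith.comp_absolutelyContinuousOnInterval hy.ac
        (mapsTo_univ _ _)
    exact h1.sub (hw.absolutelyContinuous hS)
  have key := hac.eq_add_integral hS.1 (k := 0) intervalIntegrable_const (by
    filter_upwards [IsACSolution.ae_hasDerivAt hy] with t ht hts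
    have h1 : HasDerivAt (fun t => (y t).2) (derivWithin w (Icc 0 T) t) t := by
      have := (ContinuousLinearMap.snd ℝ (Vec n) (Vec m)).hasFDerivAt.comp_hasDerivAt t (ht hts)
      simpa [combG_snd, augF, Function.comp_def] using this
    simpa using h1.fun_sub (hw.hasDerivAt ⟨hts.1, hts.2.trans_le hS.2⟩))
  intro t ht
  have h2 := key t ht
  have h3 := IsACSolution.initial hS.1 hy
  simpa [h3, sub_eq_zero] using h2

theorem IsOrdinaryControl.ae_mem (ha : IsOrdinaryControl A T a) (hS : S ∈ Icc 0 T) :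
    ∀ᵐ t ∂(volume.restrict (Icc 0 S)), a t ∈ A :=
  ae_mono (Measure.restrict_mono (Icc_subset_Icc_right hS.2) le_rfl) ha.2

theorem IsOrdinaryControl.aestronglyMeasurable (ha : IsOrdinaryControl A T a)
    (hS : S ∈ Icc 0 T) : AEStronglyMeasurable a (volume.restrict (Icc 0 S)) :=
  (ha.1.mono_set (Icc_subset_Icc_right hS.2)).aestronglyMeasurable

/-- A bounded function that is measurable on `[0,S]` is interval integrable. -/
theorem intervalIntegrable_of_ae_bound {E : Type*} [NormedAddCommGroup E] {k : ℝ → E} {C : ℝ}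
    (hS : 0 ≤ S) (hk : AEStronglyMeasurable k (volume.restrict (Icc 0 S)))
    (hC : ∀ᵐ t ∂(volume.restrict (Icc 0 S)), ‖k t‖ ≤ C) : IntervalIntegrable k volume 0 S := by
  rw [intervalIntegrable_iff_integrableOn_Icc_of_le hS]
  exact Integrable.of_bound hk C hC

theorem intervalIntegrable_transF (hU : IsClosed U) (hA : IsCompact A)
    (hf : DriftAssumption f U A) (hg : FieldAssumption g U) (ha : IsOrdinaryControl A T a)
    (hS : S ∈ Icc 0 T) {q : ℝ → Vec n × Vec m} {r : ℝ}
    (hq : AEStronglyMeasurable q (volume.restrict (Icc 0 S)))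
    (hqr : ∀ t ∈ Icc 0 S, q t ∈ boundedCylinder n U r) :
    IntervalIntegrable (fun t => transF f g U (q t) (a t)) volume 0 S := by
  obtain ⟨L, -, C, -, h⟩ := exists_transF_estimates hU hA hf hg r
  have hqr' : ∀ᵐ t ∂(volume.restrict (Icc 0 S)), q t ∈ boundedCylinder n U r :=
    (ae_restrict_iff' measurableSet_Icc).2 (Eventually.of_forall hqr)
  refine intervalIntegrable_of_ae_bound hS.1 (C := C) (aestronglyMeasurable_comp₂
    (isCompact_boundedCylinder hU r).isClosed hA.isClosed (fun a ha p hp => (h a ha p hp).2)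
    (fun p hp => transF_continuousOn hf hg hp.2.2) hq (ha.aestronglyMeasurable hS) hqr'
    (ha.ae_mem hS)) ?_
  filter_upwards [hqr', ha.ae_mem hS] with t h1 h2 using (h _ h2 _ h1).1

/-- The change of coordinates turns solutions of the augmented problem into solutions of the
transformed one. -/
theorem IsSmoothSolution.straighten (hU : IsClosed U) (hA : IsCompact A)
    (hf : DriftAssumption f U A) (hg : FieldAssumption g U) (ha : IsOrdinaryControl A T a)
    (hw : IsC1Control U T w) (hS : S ∈ Icc 0 T) {y : ℝ → Vec n × Vec m}
    (hy : IsSmoothSolution f g T S x₀ w a y) :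
    IsACSolution (fun t q => transF f g U (q, w t) (a t)) S (Impulsive.straighten g (x₀, w 0))
      (fun t => Impulsive.straighten g (y t)) := by
  have hyc := IsACSolution.continuousOn hS.1 hy
  have hy2 := hy.snd_eq hw hS
  have hwU : ∀ t ∈ Icc 0 S, w t ∈ U := fun t ht => hw.2 t ⟨ht.1, ht.2.trans hS.2⟩
  have hyU : ∀ t ∈ Icc 0 S, y t ∈ (univ : Set (Vec n)) ×ˢ U := fun t ht =>
    ⟨mem_univ _, by rw [hy2 t ht]; exact hwU t ht⟩
  have hyeq : ∀ t ∈ Icc 0 S, y t = ((y t).1, w t) := fun t ht => Prod.ext rfl (hy2 t ht)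
  have hK := isCompact_Icc.image_of_continuousOn hyc
  have hKU : y '' Icc 0 S ⊆ univ ×ˢ U := by rintro _ ⟨t, ht, rfl⟩; exact hyU t ht
  obtain ⟨K, hKL⟩ := ((straighten_locallyLipschitzOn hg).mono
    hKU).exists_lipschitzOnWith_of_compact hK
  have hac : AbsolutelyContinuousOnInterval (fun t => Impulsive.straighten g (y t)) 0 S :=
    hKL.comp_absolutelyContinuousOnInterval hy.ac (by
      rw [uIcc_of_le hS.1]; exact mapsTo_image _ _)
  have hξc : ContinuousOn (fun t => Impulsive.straighten g (y t)) (Icc 0 S) :=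
    (straighten_locallyLipschitzOn hg).continuousOn.comp hyc hyU
  obtain ⟨r, hr⟩ := isCompact_Icc.exists_bound_of_continuousOn
    (hξc.prodMk (hw.continuousOn hS))
  have hint := intervalIntegrable_transF hU hA hf hg ha hS (r := r)
    ((hξc.prodMk (hw.continuousOn hS)).aestronglyMeasurable measurableSet_Icc)
    (fun t ht => ⟨by simpa using hr t ht, mem_univ _, hwU t ht⟩)
  refine ⟨hac, hint, ?_⟩
  have key := hac.eq_add_integral hS.1 hint (by
    filter_upwards [IsACSolution.ae_hasDerivAt hy] with t ht hts
    have htI := Ioo_subset_Icc_self hts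
    have hn : Ioo 0 S ∈ 𝓝 t := Ioo_mem_nhds hts.1 hts.2
    -- the derivative of `ξ = φ(x,w)` exists; its value is found by differentiating `x = ψ(ξ,w)`
    have hξ : HasDerivAt (fun t => Impulsive.straighten g (y t))
        (straightenDeriv g (y t) _) t :=
      ((hasFDerivWithinAt_straighten hg (hyU t htI).2).comp_hasDerivWithinAt t
        (ht hts).hasDerivWithinAt fun s hs => hyU s (Ioo_subset_Icc_self hs)).hasDerivAt hn
    set η := straightenDeriv g (y t)
      (augF f (y t) (a t) + combG g (derivWithin w (Icc 0 T) t) (y t))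
    have hx : HasDerivAt (fun t => unstraighten g (Impulsive.straighten g (y t), w t))
        (unstraightenDeriv g (Impulsive.straighten g (y t), w t)
          (η, derivWithin w (Icc 0 T) t)) t :=
      (HasFDerivWithinAt.comp_hasDerivWithinAt (l := unstraighten g)
        (f := fun t => (Impulsive.straighten g (y t), w t)) t
        (hasFDerivWithinAt_unstraighten hg (hwU t htI))
        (hξ.prodMk (hw.hasDerivAt ⟨hts.1, hts.2.trans_le hS.2⟩)).hasDerivWithinAt
        fun s hs => mk_mem_prod (mem_univ _) (hwU s (Ioo_subset_Icc_self hs))).hasDerivAt hn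
    have hx' : HasDerivAt (fun t => unstraighten g (Impulsive.straighten g (y t), w t))
        (augF f (y t) (a t) + combG g (derivWithin w (Icc 0 T) t) (y t)).1 t := by
      refine ((ContinuousLinearMap.fst ℝ (Vec n) (Vec m)).hasFDerivAt.comp_hasDerivAt t
        (ht hts)).congr_of_eventuallyEq ?_
      filter_upwards [hn] with s hs
      have hs' := Ioo_subset_Icc_self hs
      rw [hyeq s hs', unstraighten_straighten hg _ (hwU s hs')]
      rfl
    have huniq := hx.unique hx'
    have hun : unstraighten g (Impulsive.straighten g (y t), w t) = (y t).1 := by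
      conv_lhs => rw [hyeq t htI]
      exact unstraighten_straighten hg _ (hwU t htI)
    have hη : unstraightenDeriv g (Impulsive.straighten g (y t), w t) (η, 0) = f (y t) (a t) := by
      have h1 : ((η, derivWithin w (Icc 0 T) t) : Vec n × Vec m) =
          (η, 0) + (0, derivWithin w (Icc 0 T) t) := by simp
      rw [h1, map_add, unstraightenDeriv_snd hg _ (hwU t htI), hun, ← hyeq t htI, Prod.fst_add]
        at huniq
      exact add_right_cancel huniq
    have hval : transF f g U (Impulsive.straighten g (y t), w t) (a t) = η := by
      rw [transF_eq hg (hwU t htI)]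
      change straightenDeriv g (unstraighten g (Impulsive.straighten g (y t), w t), w t)
        (f (unstraighten g (Impulsive.straighten g (y t), w t), w t) (a t), 0) = η
      conv_lhs =>
        rw [show f (unstraighten g (Impulsive.straighten g (y t), w t), w t) (a t) =
          f (y t) (a t) by rw [hun, ← hyeq t htI], ← hη]
      exact straightenDeriv_unstraightenDeriv hg _ (hwU t htI) η
    rw [hval]
    exact hξ)
  intro t ht
  rw [key t ht, IsACSolution.initial hS.1 hy]

/-- Conversely, solutions of the transformed problem come from solutions of the augmented one. -/
theorem isSmoothSolution_unstraighten (hT : 0 < T) (hA : IsCompact A)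
    (hf : DriftAssumption f U A) (hg : FieldAssumption g U) (ha : IsOrdinaryControl A T a)
    (hw : IsC1Control U T w) (hS : S ∈ Icc 0 T) {ξ : ℝ → Vec n}
    (hξ : IsACSolution (fun t q => transF f g U (q, w t) (a t)) S
      (Impulsive.straighten g (x₀, w 0)) ξ) :
    IsSmoothSolution f g T S x₀ w a (fun t => (unstraighten g (ξ t, w t), w t)) := by
  have hξc := hξ.continuousOn hS.1
  have hwc := hw.continuousOn hS
  have hwU : ∀ t ∈ Icc 0 S, w t ∈ U := fun t ht => hw.2 t ⟨ht.1, ht.2.trans hS.2⟩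
  have hpU : ∀ t ∈ Icc 0 S, (ξ t, w t) ∈ (univ : Set (Vec n)) ×ˢ U := fun t ht =>
    ⟨mem_univ _, hwU t ht⟩
  have hpc : ContinuousOn (fun t => (ξ t, w t)) (Icc 0 S) := hξc.prodMk hwc
  have hxc : ContinuousOn (fun t => unstraighten g (ξ t, w t)) (Icc 0 S) :=
    (unstraighten_locallyLipschitzOn hg).continuousOn.comp hpc hpU
  have hyc : ContinuousOn (fun t => (unstraighten g (ξ t, w t), w t)) (Icc 0 S) := hxc.prodMk hwc
  have hKU : (fun t => (ξ t, w t)) '' Icc 0 S ⊆ univ ×ˢ U := by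
    rintro _ ⟨t, ht, rfl⟩; exact hpU t ht
  obtain ⟨K, hKL⟩ := ((unstraighten_locallyLipschitzOn hg).mono
    hKU).exists_lipschitzOnWith_of_compact (isCompact_Icc.image_of_continuousOn hpc)
  have hac : AbsolutelyContinuousOnInterval (fun t => (unstraighten g (ξ t, w t), w t)) 0 S := by
    refine AbsolutelyContinuousOnInterval.prodMk ?_ (hw.absolutelyContinuous hS)
    refine hKL.comp_absolutelyContinuousOnInterval
      (hξ.ac.prodMk (hw.absolutelyContinuous hS)) ?_
    rw [uIcc_of_le hS.1]
    exact mapsTo_image _ _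
  have hYK := isCompact_Icc.image_of_continuousOn hyc
  have hYU : (fun t => (unstraighten g (ξ t, w t), w t)) '' Icc 0 S ⊆ univ ×ˢ U := by
    rintro _ ⟨t, ht, rfl⟩; exact ⟨mem_univ _, hwU t ht⟩
  obtain ⟨L, -, hL⟩ := hf.exists_lipschitz hA hYK hYU
  obtain ⟨C, -, hC⟩ := hf.exists_bound hYK hYU
  have hYmem : ∀ᵐ t ∂(volume.restrict (Icc 0 S)), (unstraighten g (ξ t, w t), w t) ∈
      (fun t => (unstraighten g (ξ t, w t), w t)) '' Icc 0 S :=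
    (ae_restrict_iff' measurableSet_Icc).2 (Eventually.of_forall fun t ht => mem_image_of_mem _ ht)
  have hint1 : IntervalIntegrable (fun t => f (unstraighten g (ξ t, w t), w t) (a t))
      volume 0 S := by
    refine intervalIntegrable_of_ae_bound hS.1 (C := C) (aestronglyMeasurable_comp₂ hYK.isClosed
      hA.isClosed hL (fun p hp => hf.continuous p (hYU hp))
      (hyc.aestronglyMeasurable measurableSet_Icc) (ha.aestronglyMeasurable hS) hYmem
      (ha.ae_mem hS)) ?_
    filter_upwards [hYmem, ha.ae_mem hS] with t h1 h2 using hC _ h2 _ h1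
  have hint2 : IntervalIntegrable (fun t => combG g (derivWithin w (Icc 0 T) t)
      (unstraighten g (ξ t, w t), w t)) volume 0 S := by
    refine ContinuousOn.intervalIntegrable ?_
    rw [uIcc_of_le hS.1]
    have hdw : ContinuousOn (derivWithin w (Icc 0 T)) (Icc 0 S) :=
      (hw.1.continuousOn_derivWithin (uniqueDiffOn_Icc hT) le_rfl).mono
        (Icc_subset_Icc_right hS.2)
    have h1 : Continuous fun q : (Vec n × Vec m) × Vec m => (stateField g q).1 :=
      (stateField_contDiff hg.smooth).continuous.fst
    exact h1.comp_continuousOn (hyc.prodMk hdw)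
  have hint : IntervalIntegrable (fun t => augF f (unstraighten g (ξ t, w t), w t) (a t) +
      combG g (derivWithin w (Icc 0 T) t) (unstraighten g (ξ t, w t), w t)) volume 0 S := by
    refine IntervalIntegrable.add ?_ hint2
    exact ⟨hint1.1.prodMk integrableOn_zero, hint1.2.prodMk integrableOn_zero⟩
  refine ⟨hac, hint, ?_⟩
  have key := hac.eq_add_integral hS.1 hint (by
    filter_upwards [hξ.ae_hasDerivAt] with t ht hts
    have htI := Ioo_subset_Icc_self hts
    have hn : Ioo 0 S ∈ 𝓝 t := Ioo_mem_nhds hts.1 hts.2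
    have hwd := hw.hasDerivAt ⟨hts.1, hts.2.trans_le hS.2⟩
    have hx : HasDerivAt (fun t => unstraighten g (ξ t, w t))
        (unstraightenDeriv g (ξ t, w t)
          (transF f g U (ξ t, w t) (a t), derivWithin w (Icc 0 T) t)) t :=
      (HasFDerivWithinAt.comp_hasDerivWithinAt (l := unstraighten g) (f := fun t => (ξ t, w t)) t
        (hasFDerivWithinAt_unstraighten hg (hwU t htI))
        ((ht hts).prodMk hwd).hasDerivWithinAt
        fun s hs => hpU s (Ioo_subset_Icc_self hs)).hasDerivAt hn
    have hval : unstraightenDeriv g (ξ t, w t)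
        (transF f g U (ξ t, w t) (a t), derivWithin w (Icc 0 T) t) =
        (augF f (unstraighten g (ξ t, w t), w t) (a t) +
          combG g (derivWithin w (Icc 0 T) t) (unstraighten g (ξ t, w t), w t)).1 := by
      have h1 : ((transF f g U (ξ t, w t) (a t), derivWithin w (Icc 0 T) t) : Vec n × Vec m) =
          (transF f g U (ξ t, w t) (a t), 0) + (0, derivWithin w (Icc 0 T) t) := by simp
      have h2 := unstraightenDeriv_straightenDeriv hg (unstraighten g (ξ t, w t)) (hwU t htI)
        (f (unstraighten g (ξ t, w t), w t) (a t))
      rw [straighten_unstraighten hg _ (hwU t htI)] at h2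
      rw [h1, map_add, unstraightenDeriv_snd hg _ (hwU t htI), transF_eq hg (hwU t htI),
        Prod.fst_add]
      exact congrArg (· + _) h2
    rw [hval] at hx
    have hsnd : (augF f (unstraighten g (ξ t, w t), w t) (a t) +
        combG g (derivWithin w (Icc 0 T) t) (unstraighten g (ξ t, w t), w t)).2 =
        derivWithin w (Icc 0 T) t := by
      rw [Prod.snd_add, combG_snd]; simp [augF]
    rw [← hsnd] at hwd
    exact hx.prodMk hwd)
  intro t ht
  have h0 : (unstraighten g (ξ 0, w 0), w 0) = (x₀, w 0) := by
    rw [hξ.initial hS.1, unstraighten_straighten hg _ (hwU 0 ⟨le_rfl, hS.1⟩)]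
  rw [key t ht]
  exact congrArg (· + _) h0

end

section

/-! ### The truncated transformed problem -/

variable {n m l : ℕ} {f : Vec n × Vec m → Vec l → Vec n} {g : Fin m → Vec n × Vec m → Vec n}
  {U : Set (Vec m)} {A : Set (Vec l)} {T S : ℝ} {w : ℝ → Vec m} {a : ℝ → Vec l} {x₀ : Vec n}

/-- Truncation of all coordinates at `±B`: a Lipschitz retraction onto a cube containing the ball of
radius `B`. -/
def clamp (B : ℝ) (x : Vec n) : Vec n :=
  WithLp.toLp 2 fun i => max (-B) (min B (x i))

theorem norm_clamp_sub_le (B : ℝ) (x y : Vec n) : ‖clamp B x - clamp B y‖ ≤ ‖x - y‖ := by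
  rw [EuclideanSpace.norm_eq, EuclideanSpace.norm_eq]
  refine Real.sqrt_le_sqrt (Finset.sum_le_sum fun i _ => pow_le_pow_left₀ (norm_nonneg _) ?_ 2)
  simp only [clamp, PiLp.sub_apply, Real.norm_eq_abs]
  refine (abs_max_sub_max_le_max _ _ _ _).trans (max_le (by simp) ?_)
  exact (abs_min_sub_min_le_max _ _ _ _).trans (max_le (by simp) le_rfl)

theorem clamp_of_norm_le {B : ℝ} {x : Vec n} (hx : ‖x‖ ≤ B) : clamp B x = x := by
  ext i
  have h := abs_le.1 ((PiLp.norm_apply_le x i).trans hx)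
  simp [clamp, h.1, h.2]

theorem exists_norm_clamp_le (n : ℕ) {B : ℝ} (hB : 0 ≤ B) :
    ∃ r : ℝ, ∀ x : Vec n, ‖clamp B x‖ ≤ r := by
  refine ⟨Real.sqrt (∑ _i : Fin n, B ^ 2), fun x => ?_⟩
  rw [EuclideanSpace.norm_eq]
  refine Real.sqrt_le_sqrt (Finset.sum_le_sum fun i _ => pow_le_pow_left₀ (norm_nonneg _) ?_ 2)
  simp only [clamp, Real.norm_eq_abs]
  exact abs_le.2 ⟨le_max_left _ _, max_le (by linarith) (min_le_left _ _)⟩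

theorem clamp_continuous (B : ℝ) : Continuous (clamp B : Vec n → Vec n) :=
  (LipschitzWith.of_dist_le_mul (K := 1) fun x y => by
    simpa [dist_eq_norm] using norm_clamp_sub_le B x y).continuous

/-- `ξ` solves the transformed problem with the state clamped at `B`. -/
structure IsClampedSolution (f : Vec n × Vec m → Vec l → Vec n)
    (g : Fin m → Vec n × Vec m → Vec n) (U : Set (Vec m)) (B T : ℝ) (η : ℝ → Vec m)
    (a : ℝ → Vec l) (ξ : ℝ → Vec n) : Prop where
  continuousOn : ContinuousOn ξ (Icc 0 T)
  eq : ∀ t ∈ Icc 0 T, ξ t = ξ 0 + ∫ s in (0 : ℝ)..t, transF f g U (clamp B (ξ s), η s) (a s)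

/-- `η` is a measurable path in the part of `U` of norm at most `R`. -/
structure IsBoundedPath (U : Set (Vec m)) (R T : ℝ) (η : ℝ → Vec m) : Prop where
  aestronglyMeasurable : AEStronglyMeasurable η (volume.restrict (Icc 0 T))
  mem : ∀ t ∈ Icc 0 T, η t ∈ U
  norm_le : ∀ t ∈ Icc 0 T, ‖η t‖ ≤ R

theorem IsC1Control.isBoundedPath (hw : IsC1Control U T w) {R : ℝ}
    (hR : ∀ t ∈ Icc 0 T, ‖w t‖ ≤ R) : IsBoundedPath U R T w :=
  ⟨hw.1.continuousOn.aestronglyMeasurable measurableSet_Icc, hw.2, hR⟩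

theorem IsBoundedPath.integrableOn {R : ℝ} {η : ℝ → Vec m} (h : IsBoundedPath U R T η) :
    IntegrableOn η (Icc 0 T) :=
  Integrable.of_bound h.aestronglyMeasurable R
    ((ae_restrict_iff' measurableSet_Icc).2 (Eventually.of_forall h.norm_le))

theorem IsBoundedPath.clamp_mem {B R r : ℝ} {η : ℝ → Vec m} (hη : IsBoundedPath U R T η)
    (hr : ∀ x : Vec n, ‖clamp B x‖ ≤ r) {t : ℝ} (ht : t ∈ Icc 0 T) (x : Vec n) :
    (clamp B x, η t) ∈ boundedCylinder n U (max r R) := by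
  refine ⟨?_, mem_univ _, hη.mem t ht⟩
  rw [mem_closedBall_zero_iff]
  exact max_le_max (hr x) (hη.norm_le t ht)

theorem intervalIntegrable_clamped (hU : IsClosed U) (hA : IsCompact A)
    (hf : DriftAssumption f U A) (hg : FieldAssumption g U) (ha : IsOrdinaryControl A T a)
    {B R : ℝ} (hT : 0 ≤ T) (hB : 0 ≤ B) {η : ℝ → Vec m} (hη : IsBoundedPath U R T η)
    {ξ : ℝ → Vec n} (hξ : ContinuousOn ξ (Icc 0 T)) :
    IntervalIntegrable (fun t => transF f g U (clamp B (ξ t), η t) (a t)) volume 0 T := by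
  obtain ⟨r, hr⟩ := exists_norm_clamp_le n hB
  exact intervalIntegrable_transF hU hA hf hg ha ⟨hT, le_rfl⟩
    ((((clamp_continuous B).comp_continuousOn hξ).aestronglyMeasurable
      measurableSet_Icc).prodMk hη.aestronglyMeasurable)
    (fun t ht => hη.clamp_mem hr ht (ξ t))

theorem exists_isClampedSolution (hU : IsClosed U) (hA : IsCompact A)
    (hf : DriftAssumption f U A) (hg : FieldAssumption g U) (ha : IsOrdinaryControl A T a)
    {B R : ℝ} (hT : 0 ≤ T) (hB : 0 ≤ B) {η : ℝ → Vec m} (hη : IsBoundedPath U R T η)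
    (ξ₀ : Vec n) : ∃ ξ, ξ 0 = ξ₀ ∧ IsClampedSolution f g U B T η a ξ := by
  obtain ⟨r, hr⟩ := exists_norm_clamp_le n hB
  obtain ⟨L, hL0, C, -, hL⟩ := exists_transF_estimates hU hA hf hg (max r R)
  obtain ⟨ξ, hξc, hξ⟩ := exists_continuous_eq_add_integral
    (G := fun t x => transF f g U (clamp B x, η t) (a t)) hT ⟨L, hL0⟩
    (fun y hy => intervalIntegrable_clamped hU hA hf hg ha hT hB hη hy.continuousOn)
    (by
      filter_upwards [ha.2, ae_restrict_mem measurableSet_Icc] with t hat ht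
      refine LipschitzWith.of_dist_le_mul fun x y => ?_
      rw [dist_eq_norm, dist_eq_norm]
      refine ((hL _ hat _ (hη.clamp_mem hr ht x)).2 _ (hη.clamp_mem hr ht y)).trans ?_
      refine mul_le_mul_of_nonneg_left ?_ hL0
      simpa [Prod.norm_def] using norm_clamp_sub_le B x y) ξ₀
  have h0 : ξ 0 = ξ₀ := by simpa using hξ 0 ⟨le_rfl, hT⟩
  exact ⟨ξ, h0, hξc.continuousOn, by rw [h0]; exact hξ⟩

/-- Solutions of the clamped problem depend continuously on the initial value and, in `L^1`, on the
path `η`. -/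
theorem exists_clamped_stability (hU : IsClosed U) (hA : IsCompact A)
    (hf : DriftAssumption f U A) (hg : FieldAssumption g U) (ha : IsOrdinaryControl A T a)
    {B : ℝ} (R : ℝ) (hT : 0 ≤ T) (hB : 0 ≤ B) :
    ∃ C : ℝ, 0 ≤ C ∧ ∀ (η η' : ℝ → Vec m) (ξ ξ' : ℝ → Vec n),
      IsBoundedPath U R T η → IsBoundedPath U R T η' →
      IsClampedSolution f g U B T η a ξ → IsClampedSolution f g U B T η' a ξ' →
      ∀ t ∈ Icc 0 T, ‖ξ t - ξ' t‖ ≤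
        C * (‖ξ 0 - ξ' 0‖ + ∫ s in Icc 0 T, ‖η s - η' s‖) := by
  obtain ⟨r, hr⟩ := exists_norm_clamp_le n hB
  obtain ⟨L, hL0, C, -, hL⟩ := exists_transF_estimates hU hA hf hg (max r R)
  refine ⟨(1 + L) * Real.exp (L * T), by positivity, fun η η' ξ ξ' hη hη' hξ hξ' t ht => ?_⟩
  set I := ∫ s in Icc 0 T, ‖η s - η' s‖
  have hI : 0 ≤ I := integral_nonneg fun s => norm_nonneg _
  have hηint : IntegrableOn (fun s => ‖η s - η' s‖) (Icc 0 T) :=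
    (hη.integrableOn.sub hη'.integrableOn).norm
  have hξint : ContinuousOn (fun s => ‖ξ s - ξ' s‖) (Icc 0 T) :=
    (hξ.continuousOn.sub hξ'.continuousOn).norm
  have key := le_mul_exp_of_le_add_integral (δ := ‖ξ 0 - ξ' 0‖ + L * I) hL0 hξint
    (fun t ht => by
      have hsub : uIcc 0 t ⊆ uIcc 0 T := by
        rw [uIcc_of_le ht.1, uIcc_of_le hT]; exact Icc_subset_Icc_right ht.2
      have i1 : IntervalIntegrable (fun s => ‖η s - η' s‖) volume 0 t :=
        (intervalIntegrable_iff_integrableOn_Icc_of_le ht.1).2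
          (hηint.mono_set (Icc_subset_Icc_right ht.2))
      have i2 : IntervalIntegrable (fun s => ‖ξ s - ξ' s‖) volume 0 t := by
        refine ContinuousOn.intervalIntegrable ?_
        rw [uIcc_of_le ht.1]
        exact hξint.mono (Icc_subset_Icc_right ht.2)
      have h1 : ξ t - ξ' t = (ξ 0 - ξ' 0) + ∫ s in (0 : ℝ)..t,
          (transF f g U (clamp B (ξ s), η s) (a s) -
            transF f g U (clamp B (ξ' s), η' s) (a s)) := by
        rw [intervalIntegral.integral_sub
          ((intervalIntegrable_clamped hU hA hf hg ha hT hB hη hξ.continuousOn).mono_set hsub)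
          ((intervalIntegrable_clamped hU hA hf hg ha hT hB hη' hξ'.continuousOn).mono_set hsub),
          hξ.eq t ht, hξ'.eq t ht]
        abel
      have h2 : ‖∫ s in (0 : ℝ)..t, (transF f g U (clamp B (ξ s), η s) (a s) -
            transF f g U (clamp B (ξ' s), η' s) (a s))‖ ≤
          ∫ s in (0 : ℝ)..t, (L * ‖η s - η' s‖ + L * ‖ξ s - ξ' s‖) := by
        refine intervalIntegral.norm_integral_le_of_norm_le ht.1 ?_
          ((i1.const_mul L).add (i2.const_mul L))
        filter_upwards [(ae_restrict_iff' measurableSet_Icc).1 ha.2] with s has hs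
        have hs' : s ∈ Icc 0 T := ⟨hs.1.le, hs.2.trans ht.2⟩
        refine ((hL _ (has hs') _ (hη.clamp_mem hr hs' _)).2 _
          (hη'.clamp_mem hr hs' _)).trans ?_
        rw [← mul_add]
        refine mul_le_mul_of_nonneg_left (max_le ?_ ?_) hL0
        · exact (norm_clamp_sub_le B _ _).trans (le_add_of_nonneg_left (norm_nonneg _))
        · exact le_add_of_nonneg_right (norm_nonneg _)
      rw [intervalIntegral.integral_add (i1.const_mul L) (i2.const_mul L),
        intervalIntegral.integral_const_mul, intervalIntegral.integral_const_mul] at h2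
      have h3 : ∫ s in (0 : ℝ)..t, ‖η s - η' s‖ ≤ I := by
        rw [intervalIntegral.integral_of_le ht.1]
        exact setIntegral_mono_set hηint (Eventually.of_forall fun s => norm_nonneg _)
          (Eventually.of_forall (Ioc_subset_Icc_self.trans (Icc_subset_Icc_right ht.2)))
      have h4 := mul_le_mul_of_nonneg_left h3 hL0
      rw [h1]
      refine (norm_add_le _ _).trans ?_
      linarith) t ht
  have h5 : Real.exp (L * t) ≤ Real.exp (L * T) :=
    Real.exp_le_exp.2 (mul_le_mul_of_nonneg_left ht.2 hL0)
  have h6 : ‖ξ 0 - ξ' 0‖ + L * I ≤ (1 + L) * (‖ξ 0 - ξ' 0‖ + I) := by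
    have := mul_nonneg hL0 (norm_nonneg (ξ 0 - ξ' 0))
    nlinarith
  calc ‖ξ t - ξ' t‖ ≤ _ := key
    _ ≤ (1 + L) * (‖ξ 0 - ξ' 0‖ + I) * Real.exp (L * T) :=
        mul_le_mul h6 h5 (Real.exp_pos _).le (by positivity)
    _ = _ := by ring

/-- A clamped solution that stays in the ball of radius `B` solves the transformed problem. -/
theorem IsClampedSolution.isACSolution (hU : IsClosed U) (hA : IsCompact A)
    (hf : DriftAssumption f U A) (hg : FieldAssumption g U) (ha : IsOrdinaryControl A T a)
    {B R : ℝ} (hB : 0 ≤ B) {η : ℝ → Vec m} (hη : IsBoundedPath U R T η)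
    {ξ : ℝ → Vec n} (hξ : IsClampedSolution f g U B T η a ξ) (hS : S ∈ Icc 0 T)
    (hle : ∀ t ∈ Icc 0 S, ‖ξ t‖ ≤ B) :
    IsACSolution (fun t q => transF f g U (q, η t) (a t)) S (ξ 0) ξ := by
  have hT : 0 ≤ T := hS.1.trans hS.2
  have hsub : uIcc 0 S ⊆ uIcc 0 T := by
    rw [uIcc_of_le hS.1, uIcc_of_le hT]; exact Icc_subset_Icc_right hS.2
  have hint := (intervalIntegrable_clamped hU hA hf hg ha hT hB hη hξ.continuousOn).mono_set hsub
  have hac : AbsolutelyContinuousOnInterval ξ 0 S := by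
    refine hint.absolutelyContinuousOnInterval_integral.of_dist_le (C := 1)
      hint.absolutelyContinuousOnInterval_integral fun x hx y hy => ?_
    rw [uIcc_of_le hS.1] at hx hy
    rw [hξ.eq x ⟨hx.1, hx.2.trans hS.2⟩, hξ.eq y ⟨hy.1, hy.2.trans hS.2⟩, dist_add_left, one_mul]
    exact le_add_of_nonneg_right dist_nonneg
  refine ⟨hac, hint.congr fun s hs => ?_, fun t ht => ?_⟩
  · rw [uIoc_of_le hS.1] at hs
    replace hs := Ioc_subset_Icc_self hs
    simp only [clamp_of_norm_le (hle s hs)]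
  · rw [hξ.eq t ⟨ht.1, ht.2.trans hS.2⟩]
    congr 1
    refine intervalIntegral.integral_congr fun s hs => ?_
    rw [uIcc_of_le ht.1] at hs
    simp only [clamp_of_norm_le (hle s ⟨hs.1, hs.2.trans ht.2⟩)]

theorem IsACSolution.isClampedSolution {B : ℝ} (hT : 0 ≤ T) {η : ℝ → Vec m} {ξ₀ : Vec n}
    {ξ : ℝ → Vec n} (hξ : IsACSolution (fun t q => transF f g U (q, η t) (a t)) T ξ₀ ξ)
    (hle : ∀ t ∈ Icc 0 T, ‖ξ t‖ ≤ B) : IsClampedSolution f g U B T η a ξ := by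
  refine ⟨hξ.continuousOn hT, fun t ht => ?_⟩
  rw [hξ.eq t ht, hξ.initial hT]
  congr 1
  refine intervalIntegral.integral_congr fun s hs => ?_
  rw [uIcc_of_le ht.1] at hs
  simp only [clamp_of_norm_le (hle s ⟨hs.1, hs.2.trans ht.2⟩)]

/-- The a priori bound in the new coordinates. -/
theorem exists_transformed_bound (hT : 0 < T) (hU : IsClosed U) (hA : IsCompact A)
    (hf : DriftAssumption f U A) (hg : FieldAssumption g U) (hbound : AprioriBound f g U A T)
    (ha : IsOrdinaryControl A T a) (x₀ : Vec n) (R : ℝ) :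
    ∃ B : ℝ, 0 ≤ B ∧ (∀ z ∈ U, ‖z‖ ≤ R → ‖straighten g (x₀, z)‖ ≤ B) ∧
      ∀ w, IsC1Control U T w → (∀ t ∈ Icc 0 T, ‖w t‖ ≤ R) → ∀ S ∈ Icc 0 T, ∀ ξ,
        IsACSolution (fun t q => transF f g U (q, w t) (a t)) S (straighten g (x₀, w 0)) ξ →
        ∀ t ∈ Icc 0 S, ‖ξ t‖ ≤ B := by
  obtain ⟨N, hN⟩ := hbound (‖x₀‖ + R)
  -- the radius `max N ‖x₀‖` covers the trajectories as well as the initial state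
  obtain ⟨B, hB⟩ := (isCompact_boundedCylinder (n := n) hU
    (max (max N ‖x₀‖) R)).exists_bound_of_continuousOn
    ((straighten_locallyLipschitzOn hg).continuousOn.mono (boundedCylinder_subset _))
  have hmem : ∀ x : Vec n, ‖x‖ ≤ max N ‖x₀‖ → ∀ z ∈ U, ‖z‖ ≤ R →
      ‖straighten g (x, z)‖ ≤ max B 0 := fun x hx z hz hzR =>
    (hB (x, z) ⟨mem_closedBall_zero_iff.2 (max_le_max hx hzR), mem_univ _, hz⟩).trans
      (le_max_left _ _)
  refine ⟨max B 0, le_max_right _ _, fun z hz hzR => hmem x₀ (le_max_right _ _) z hz hzR,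
    fun w hw hwR S hS ξ hξ t ht => ?_⟩
  have htT : t ∈ Icc 0 T := ⟨ht.1, ht.2.trans hS.2⟩
  have hy := isSmoothSolution_unstraighten hT hA hf hg ha hw hS hξ
  have h1 := hN x₀ w a S _ hw ha (fun t ht => by gcongr; exact hwR t ht) hS hy t ht
  have h2 := hmem _ (h1.trans (le_max_left _ _)) (w t) (hw.2 t htT) (hwR t htT)
  rwa [straighten_unstraighten hg _ (hw.2 t htT)] at h2

/-- For a `C^1` control the clamped solution never meets the truncation. -/
theorem IsClampedSolution.norm_le (hU : IsClosed U) (hA : IsCompact A)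
    (hf : DriftAssumption f U A) (hg : FieldAssumption g U) (ha : IsOrdinaryControl A T a)
    {B R : ℝ} (hB : 0 ≤ B) (hw : IsC1Control U T w) (hwR : ∀ t ∈ Icc 0 T, ‖w t‖ ≤ R)
    (hB0 : ‖straighten g (x₀, w 0)‖ ≤ B)
    (hBS : ∀ S ∈ Icc 0 T, ∀ ξ,
        IsACSolution (fun t q => transF f g U (q, w t) (a t)) S (straighten g (x₀, w 0)) ξ →
        ∀ t ∈ Icc 0 S, ‖ξ t‖ ≤ B)
    {ξ : ℝ → Vec n} (hξ : IsClampedSolution f g U (B + 1) T w a ξ)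
    (hξ0 : ξ 0 = straighten g (x₀, w 0)) : ∀ t ∈ Icc 0 T, ‖ξ t‖ ≤ B := by
  refine forall_le_of_forall_improve hξ.continuousOn.norm (B := B + 1) (by linarith)
    (by rw [hξ0]; linarith) fun S hS hle => ?_
  have h1 := hξ.isACSolution hU hA hf hg ha (by linarith) (hw.isBoundedPath hwR) hS hle
  rw [hξ0] at h1
  exact hBS S hS ξ h1 S ⟨hS.1, le_rfl⟩

end

/-! ### Approximation of impulsive controls by smooth ones -/

section Approximation

variable {E : Type*} [NormedAddCommGroup E] [NormedSpace ℝ E]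

/-- `γ : ℝ → V` is a `C^1` path equal to `x` on `(-∞,0]` and to `y` on `[b,∞)`. -/
structure IsC1Path (V : Set E) (x y : E) (b : ℝ) (γ : ℝ → E) : Prop where
  nonneg : 0 ≤ b
  contDiff : ContDiff ℝ 1 γ
  mem : ∀ t, γ t ∈ V
  left : ∀ t ≤ 0, γ t = x
  right : ∀ t, b ≤ t → γ t = y

/-- Concatenation of paths that are constant near their ends. -/
theorem IsC1Path.concat {V : Set E} {x y z : E} {b c : ℝ} {γ δ : ℝ → E} (hγ : IsC1Path V x y b γ)
    (hδ : IsC1Path V y z c δ) :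
    ∃ ε, IsC1Path V x z (b + c) ε ∧ ∀ t ≤ b, ε t = γ t := by
  have h1 : ∀ t ≤ b, γ t + δ (t - b) - y = γ t := fun t ht => by
    rw [hδ.left _ (by linarith)]; abel
  have h2 : ∀ t, b ≤ t → γ t + δ (t - b) - y = δ (t - b) := fun t ht => by
    rw [hγ.right _ ht]; abel
  have hb := hγ.nonneg
  have hc := hδ.nonneg
  refine ⟨fun t => γ t + δ (t - b) - y, ⟨by linarith, ?_, fun t => ?_, fun t ht => ?_,
    fun t ht => ?_⟩, h1⟩
  · exact (hγ.contDiff.add (hδ.contDiff.comp (contDiff_id.sub contDiff_const))).sub contDiff_const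
  · rcases le_total t b with h | h
    · simp only [h1 t h, hγ.mem]
    · simp only [h2 t h, hδ.mem]
  · exact (h1 t (by linarith)).trans (hγ.left t ht)
  · exact (h2 t (by linarith)).trans (hδ.right (t - b) (by linarith))

theorem exists_isC1Path {V : Set E} (hV : IsOpen V) (hc : IsPreconnected V) {x y : E} (hx : x ∈ V)
    (hy : y ∈ V) : ∃ b γ, IsC1Path V x y b γ := by
  refine hc.induction₂ (fun x y => ∃ b γ, IsC1Path V x y b γ) (fun x hx => ?_) ?_ ?_ hx hy
  · obtain ⟨r, hr, hrV⟩ := Metric.isOpen_iff.1 hV x hx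
    filter_upwards [mem_nhdsWithin_of_mem_nhds (Metric.ball_mem_nhds x hr)] with y hy
    refine ⟨1, fun t => x + Real.smoothTransition t • (y - x), zero_le_one, ?_, fun t => ?_,
      fun t ht => ?_, fun t ht => ?_⟩
    · exact contDiff_const.add (Real.smoothTransition.contDiff.smul contDiff_const)
    · exact hrV ((convex_ball x r).add_smul_sub_mem (Metric.mem_ball_self hr) hy
        ⟨Real.smoothTransition.nonneg t, Real.smoothTransition.le_one t⟩)
    · simp [Real.smoothTransition.zero_of_nonpos ht]
    · simp [Real.smoothTransition.one_of_one_le ht]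
  · rintro x y z - - - ⟨b, γ, hγ⟩ ⟨c, δ, hδ⟩
    obtain ⟨ε, hε, -⟩ := hγ.concat hδ
    exact ⟨_, ε, hε⟩
  · rintro x y - - ⟨b, γ, hγ⟩
    exact ⟨b, fun t => γ (b - t), hγ.nonneg, hγ.contDiff.comp (contDiff_const.sub contDiff_id),
      fun t => hγ.mem _, fun t ht => hγ.right _ (by linarith),
      fun t ht => hγ.left _ (by linarith)⟩

/-- In a connected open set there is a `C^1` path through finitely many given points. -/
theorem exists_isC1Path_through {V : Set E} (hV : IsOpen V) (hc : IsConnected V) (F : Finset E)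
    (hF : ∀ v ∈ F, v ∈ V) :
    ∃ x y b γ, IsC1Path V x y b γ ∧ ∀ v ∈ F, ∃ t ≤ b, γ t = v := by
  classical
  induction F using Finset.induction_on with
  | empty =>
    obtain ⟨x, hx⟩ := hc.nonempty
    exact ⟨x, x, 0, fun _ => x, ⟨le_rfl, contDiff_const, fun _ => hx, fun _ _ => rfl,
      fun _ _ => rfl⟩, by simp⟩
  | insert v F _ ih =>
    obtain ⟨x, y, b, γ, hγ, hγF⟩ := ih fun v hv => hF v (Finset.mem_insert_of_mem hv)
    have hy : y ∈ V := by rw [← hγ.right b le_rfl]; exact hγ.mem b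
    obtain ⟨c, δ, hδ⟩ := exists_isC1Path hV hc.isPreconnected hy (hF v (Finset.mem_insert_self _ _))
    obtain ⟨ε, hε, hεγ⟩ := hγ.concat hδ
    refine ⟨x, v, b + c, ε, hε, fun u hu => ?_⟩
    rcases Finset.mem_insert.1 hu with rfl | hu
    · exact ⟨b + c, le_rfl, hε.right _ le_rfl⟩
    · obtain ⟨t, ht, rfl⟩ := hγF u hu
      exact ⟨t, ht.trans (le_add_of_nonneg_right hδ.nonneg), hεγ t ht⟩

theorem IsC1Path.exists_lipschitzWith {V : Set E} {x y : E} {b : ℝ} {γ : ℝ → E}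
    (h : IsC1Path V x y b γ) : ∃ K, LipschitzWith K γ := by
  obtain ⟨K, hK⟩ := (h.contDiff.contDiffOn (s := Icc 0 b)).exists_lipschitzOnWith one_ne_zero
    (convex_Icc _ _) isCompact_Icc
  refine ⟨K, LipschitzWith.of_dist_le_mul fun s t => ?_⟩
  have hproj : ∀ t, γ t = γ (projIcc 0 b h.nonneg t) := fun t => by
    rcases le_total t 0 with h1 | h1
    · rw [projIcc_of_le_left _ h1, h.left t h1, h.left 0 le_rfl]
    · rcases le_total b t with h2 | h2
      · rw [projIcc_of_right_le _ h2, h.right t h2, h.right b le_rfl]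
      · rw [projIcc_of_mem _ ⟨h1, h2⟩]
  rw [hproj s, hproj t]
  refine (hK.dist_le_mul _ (projIcc 0 b h.nonneg s).2 _ (projIcc 0 b h.nonneg t).2).trans ?_
  refine mul_le_mul_of_nonneg_left ?_ K.2
  simpa [Subtype.dist_eq] using (LipschitzWith.projIcc h.nonneg).dist_le_mul s t

/-- Polynomials are dense in `L^1(μ)` for a finite measure `μ` carried by an interval. -/
theorem exists_polynomial_lintegral_sub_le {μ : Measure ℝ} [IsFiniteMeasure μ] {T : ℝ}
    (hμ : ∀ᵐ t ∂μ, t ∈ Icc 0 T) {θ : ℝ → ℝ} (hθ : Integrable θ μ) {ε : ENNReal} (hε : ε ≠ 0) :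
    ∃ q : Polynomial ℝ, ∫⁻ t, ‖q.eval t - θ t‖ₑ ∂μ ≤ ε := by
  have hε2 : ε / 2 ≠ 0 := by simpa using hε
  obtain ⟨h, -, hh, hhc, -⟩ := hθ.exists_hasCompactSupport_lintegral_sub_le hε2
  obtain ⟨δ, hδ0, hδ⟩ := ENNReal.exists_nnreal_pos_mul_lt (measure_ne_top μ univ) hε2
  obtain ⟨q, hq⟩ := exists_polynomial_near_of_continuousOn 0 T h hhc.continuousOn δ
    (by exact_mod_cast hδ0)
  refine ⟨q, ?_⟩
  have hle : ∀ᵐ t ∂μ, ‖q.eval t - θ t‖ₑ ≤ (δ : ENNReal) + ‖θ t - h t‖ₑ := by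
    filter_upwards [hμ] with t ht
    have h1 : ‖q.eval t - h t‖ₑ ≤ δ := by
      have := hq t ht
      rw [← Real.norm_eq_abs] at this
      rw [enorm_le_coe]
      exact_mod_cast this.le
    calc ‖q.eval t - θ t‖ₑ = ‖(q.eval t - h t) - (θ t - h t)‖ₑ := by congr 1; ring
      _ ≤ ‖q.eval t - h t‖ₑ + ‖θ t - h t‖ₑ := enorm_sub_le
      _ ≤ _ := by gcongr
  calc ∫⁻ t, ‖q.eval t - θ t‖ₑ ∂μ ≤ ∫⁻ t, ((δ : ENNReal) + ‖θ t - h t‖ₑ) ∂μ :=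
        lintegral_mono_ae hle
    _ = δ * μ univ + ∫⁻ t, ‖θ t - h t‖ₑ ∂μ := by
        rw [lintegral_add_left measurable_const, lintegral_const]
    _ ≤ ε / 2 + ε / 2 := add_le_add hδ.le hh
    _ = ε := ENNReal.add_halves ε

variable [FiniteDimensional ℝ E] [MeasurableSpace E] [BorelSpace E]

/-- An integrable function with values in the closure of a connected open set `V` is the `L^1` limit
of `C^1` functions with values in `V`: a simple function with values in `V` factors through a `C^1`
path in `V` and a real simple function, and the latter is approximated by a polynomial. -/
theorem exists_contDiff_lintegral_sub_le {V : Set E} (hV : IsOpen V) (hc : IsConnected V)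
    {μ : Measure ℝ} [IsFiniteMeasure μ] {T : ℝ} (hμ : ∀ᵐ t ∂μ, t ∈ Icc 0 T) {u : ℝ → E}
    (hu : Integrable u μ) (huV : ∀ᵐ t ∂μ, u t ∈ closure V) {ε : ENNReal} (hε : ε ≠ 0) :
    ∃ w : ℝ → E, ContDiff ℝ 1 w ∧ (∀ t, w t ∈ V) ∧ ∫⁻ t, ‖w t - u t‖ₑ ∂μ ≤ ε := by
  have := FiniteDimensional.proper ℝ E
  have hε2 : ε / 2 ≠ 0 := by simpa using hε
  obtain ⟨v₀, hv₀⟩ := hc.nonempty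
  obtain ⟨u', hu', huu'⟩ := hu.aestronglyMeasurable
  have hui : Integrable u' μ := hu.congr huu'
  have hlim := SimpleFunc.tendsto_approxOn_L1_enorm hu'.measurable hv₀ (μ := μ)
    (by filter_upwards [huV, huu'] with t h1 h2; rwa [← h2])
    (hui.sub (integrable_const v₀)).2
  obtain ⟨j, hj⟩ := (hlim.eventually (ge_mem_nhds (pos_iff_ne_zero.2 hε2))).exists
  set s := SimpleFunc.approxOn u' hu'.measurable V v₀ hv₀ j
  have hsV : ∀ t, s t ∈ V := fun t => SimpleFunc.approxOn_mem hu'.measurable hv₀ j t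
  obtain ⟨x, y, b, γ, hγ, hγs⟩ := exists_isC1Path_through hV hc s.range (by
    intro v hv
    obtain ⟨t, rfl⟩ := SimpleFunc.mem_range.1 hv
    exact hsV t)
  obtain ⟨K, hK⟩ := hγ.exists_lipschitzWith
  have hsel : ∀ v, ∃ c, v ∈ s.range → γ c = v := fun v => by
    by_cases hv : v ∈ s.range
    · obtain ⟨c, -, hc⟩ := hγs v hv
      exact ⟨c, fun _ => hc⟩
    · exact ⟨0, fun h => absurd h hv⟩
  choose c hc using hsel
  -- `s` is the composition of the path `γ` with the real simple function `s.map c`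
  have hθ : Integrable (s.map c) μ := (s.map c).integrable_of_isFiniteMeasure
  have hθs : ∀ t, γ ((s.map c) t) = s t := fun t => by
    rw [SimpleFunc.map_apply]; exact hc _ (SimpleFunc.mem_range_self s t)
  obtain ⟨δ, hδ0, hδ⟩ := ENNReal.exists_nnreal_pos_mul_lt (a := K) ENNReal.coe_ne_top hε2
  obtain ⟨q, hq⟩ := exists_polynomial_lintegral_sub_le hμ hθ (ε := δ) (by exact_mod_cast hδ0.ne')
  refine ⟨fun t => γ (q.eval t), hγ.contDiff.comp (q.contDiff_aeval 1), fun t => hγ.mem _, ?_⟩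
  have hle : ∀ᵐ t ∂μ, ‖γ (q.eval t) - u t‖ₑ ≤
      K * ‖q.eval t - (s.map c) t‖ₑ + ‖s t - u' t‖ₑ := by
    filter_upwards [huu'] with t ht
    have h1 : ‖γ (q.eval t) - s t‖ₑ ≤ K * ‖q.eval t - (s.map c) t‖ₑ := by
      have := hK (q.eval t) ((s.map c) t)
      rwa [hθs, edist_eq_enorm_sub, edist_eq_enorm_sub] at this
    calc ‖γ (q.eval t) - u t‖ₑ = ‖(γ (q.eval t) - s t) + (s t - u' t)‖ₑ := by
          rw [ht]; congr 1; abel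
      _ ≤ ‖γ (q.eval t) - s t‖ₑ + ‖s t - u' t‖ₑ := enorm_add_le _ _
      _ ≤ _ := by gcongr
  have hm : Measurable fun t => (K : ENNReal) * ‖q.eval t - (s.map c) t‖ₑ :=
    ((q.continuous.measurable.sub (s.map c).measurable).enorm).const_mul _
  calc ∫⁻ t, ‖γ (q.eval t) - u t‖ₑ ∂μ
      ≤ ∫⁻ t, (K * ‖q.eval t - (s.map c) t‖ₑ + ‖s t - u' t‖ₑ) ∂μ := lintegral_mono_ae hle
    _ = K * ∫⁻ t, ‖q.eval t - (s.map c) t‖ₑ ∂μ + ∫⁻ t, ‖s t - u' t‖ₑ ∂μ := by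
        rw [lintegral_add_left hm, lintegral_const_mul' _ _ ENNReal.coe_ne_top]
    _ ≤ ε / 2 + ε / 2 := by
        refine add_le_add (le_trans ?_ hδ.le) hj
        rw [mul_comm]
        gcongr
    _ = ε := ENNReal.add_halves ε

/-- The approximation at `0` and `τ` comes for free: add Dirac masses there to Lebesgue measure. -/
theorem exists_contDiff_tendstoL1At {V : Set E} (hV : IsOpen V) (hc : IsConnected V) {T τ : ℝ}
    (hτ : τ ∈ Icc 0 T) {u : ℝ → E} (hu : IntegrableOn u (Icc 0 T))
    (huV : ∀ t ∈ Icc 0 T, u t ∈ closure V) :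
    ∃ w : ℕ → ℝ → E, (∀ k, ContDiff ℝ 1 (w k)) ∧ (∀ k t, w k t ∈ V) ∧
      TendstoL1At T {0, τ} w u := by
  set μ : Measure ℝ := volume.restrict (Icc 0 T) + (Measure.dirac 0 + Measure.dirac τ) with hμdef
  have h0 : (0 : ℝ) ∈ Icc 0 T := ⟨le_rfl, hτ.1.trans hτ.2⟩
  have hae : ∀ P : ℝ → Prop, (∀ t ∈ Icc 0 T, P t) → ∀ᵐ t ∂μ, P t := fun P hP => by
    simp only [hμdef, ae_add_measure_iff]
    refine ⟨(ae_restrict_iff' measurableSet_Icc).2 (Eventually.of_forall hP), ?_, ?_⟩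
    · rw [ae_dirac_eq]; exact hP 0 h0
    · rw [ae_dirac_eq]; exact hP τ hτ
  have hui : Integrable u μ :=
    hu.integrable.add_measure
      ((integrable_dirac (by simp)).add_measure (integrable_dirac (by simp)))
  -- in `ENNReal` the bound `k⁻¹` is positive for every `k`, and infinite for `k = 0`
  have hex : ∀ k : ℕ, ∃ w : ℝ → E, ContDiff ℝ 1 w ∧ (∀ t, w t ∈ V) ∧
      ∫⁻ t, ‖w t - u t‖ₑ ∂μ ≤ (k : ENNReal)⁻¹ := fun k =>
    exists_contDiff_lintegral_sub_le hV hc (hae _ fun t ht => ht) hui (hae _ huV) (by simp)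
  choose w hw1 hw2 hw3 using hex
  have hlim : Tendsto (fun k => ∫⁻ t, ‖w k t - u t‖ₑ ∂μ) atTop (𝓝 0) :=
    tendsto_of_tendsto_of_tendsto_of_le_of_le tendsto_const_nhds
      ENNReal.tendsto_inv_nat_nhds_zero (fun _ => zero_le) hw3
  have hsplit : ∀ k, ∫⁻ t, ‖w k t - u t‖ₑ ∂μ = (∫⁻ t in Icc 0 T, ‖w k t - u t‖ₑ) +
      (‖w k 0 - u 0‖ₑ + ‖w k τ - u τ‖ₑ) := fun k => by
    rw [hμdef, lintegral_add_measure, lintegral_add_measure, lintegral_dirac, lintegral_dirac]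
  refine ⟨w, hw1, hw2, ?_, ?_⟩
  · refine tendsto_of_tendsto_of_tendsto_of_le_of_le tendsto_const_nhds hlim
      (fun _ => zero_le) fun k => ?_
    rw [hsplit, eLpNorm_one_eq_lintegral_enorm]
    exact le_self_add
  · rintro t ht
    rw [tendsto_iff_edist_tendsto_0]
    refine tendsto_of_tendsto_of_tendsto_of_le_of_le tendsto_const_nhds hlim
      (fun _ => zero_le) fun k => ?_
    dsimp only
    rw [hsplit, edist_eq_enorm_sub]
    rcases ht with rfl | ht
    · exact le_self_add.trans le_add_self
    · rw [mem_singleton_iff] at ht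
      subst ht
      exact le_add_self.trans le_add_self

end Approximation

section

/-! ### Generalized solutions -/

variable {n m l : ℕ} {f : Vec n × Vec m → Vec l → Vec n} {g : Fin m → Vec n × Vec m → Vec n}
  {U : Set (Vec m)} {A : Set (Vec l)} {T : ℝ} {w : ℕ → ℝ → Vec m} {u : ℝ → Vec m}
  {a : ℝ → Vec l} {x₀ : Vec n}

/-- `L^1` convergence of the controls, with convergence at time `0`, gives uniform convergence of
the solutions of the clamped problem. -/
theorem exists_tendsto_clamped (hU : IsClosed U) (hA : IsCompact A)
    (hf : DriftAssumption f U A) (hg : FieldAssumption g U) (ha : IsOrdinaryControl A T a)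
    {B R : ℝ} (hT : 0 ≤ T) (hB : 0 ≤ B) (hw : ∀ k, IsBoundedPath U R T (w k))
    (hu : IsBoundedPath U R T u) {J : Set ℝ} (hJ : 0 ∈ J) (hwu : TendstoL1At T J w u)
    {ξ : ℕ → ℝ → Vec n} {ζ : ℝ → Vec n} (hξ : ∀ k, IsClampedSolution f g U B T (w k) a (ξ k))
    (hζ : IsClampedSolution f g U B T u a ζ) (hξ0 : ∀ k, ξ k 0 = straighten g (x₀, w k 0))
    (hζ0 : ζ 0 = straighten g (x₀, u 0)) :
    ∃ c : ℕ → ℝ, Tendsto c atTop (𝓝 0) ∧ ∀ k, ∀ t ∈ Icc 0 T, ‖ξ k t - ζ t‖ ≤ c k := by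
  obtain ⟨C, -, hC⟩ := exists_clamped_stability hU hA hf hg ha R hT hB
  refine ⟨_, ?_, fun k t ht => hC (w k) u (ξ k) ζ (hw k) hu (hξ k) hζ t ht⟩
  have h00 : (0 : ℝ) ∈ Icc 0 T := ⟨le_rfl, hT⟩
  have h1 : Tendsto (fun k => ∫ s in Icc 0 T, ‖w k s - u s‖) atTop (𝓝 0) := by
    have h2 := (ENNReal.tendsto_toReal ENNReal.zero_ne_top).comp hwu.1
    refine h2.congr fun k => ?_
    rw [Function.comp_apply, eLpNorm_one_eq_lintegral_enorm]
    exact (integral_norm_eq_lintegral_enorm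
      ((hw k).aestronglyMeasurable.sub hu.aestronglyMeasurable)).symm
  have h2 : Tendsto (fun k => ‖ξ k 0 - ζ 0‖) atTop (𝓝 0) := by
    rw [← tendsto_iff_norm_sub_tendsto_zero, hζ0]
    simp only [hξ0]
    have hc := (straighten_locallyLipschitzOn hg).continuousOn (x₀, u 0)
      ⟨mem_univ _, hu.mem 0 h00⟩
    have hp : Tendsto (fun k => (x₀, w k 0)) atTop (𝓝[univ ×ˢ U] (x₀, u 0)) :=
      tendsto_nhdsWithin_iff.2 ⟨tendsto_const_nhds.prodMk_nhds (hwu.2 0 hJ),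
        Eventually.of_forall fun k => ⟨mem_univ _, (hw k).mem 0 h00⟩⟩
    exact Filter.Tendsto.comp (g := straighten g) hc hp
  simpa using (h2.add h1).const_mul C

/-- If the transformed states converge uniformly, the original ones converge wherever the controls
do. -/
theorem TendstoL1At.unstraighten (hU : IsClosed U) (hg : FieldAssumption g U) {B R : ℝ}
    (hw : ∀ k, IsBoundedPath U R T (w k)) (hu : IsBoundedPath U R T u) {J : Set ℝ}
    (hJ : J ⊆ Icc 0 T) (hwu : TendstoL1At T J w u) {ξ : ℕ → ℝ → Vec n} {ζ : ℝ → Vec n}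
    (hξ : ∀ k, ∀ t ∈ Icc 0 T, ‖ξ k t‖ ≤ B) (hζ : ∀ t ∈ Icc 0 T, ‖ζ t‖ ≤ B) {c : ℕ → ℝ}
    (hc : Tendsto c atTop (𝓝 0)) (hξζ : ∀ k, ∀ t ∈ Icc 0 T, ‖ξ k t - ζ t‖ ≤ c k) :
    TendstoL1At T J (fun k t => (Impulsive.unstraighten g (ξ k t, w k t), w k t))
      (fun t => (Impulsive.unstraighten g (ζ t, u t), u t)) := by
  obtain ⟨L, hL0, hL⟩ := exists_norm_unstraighten_sub_le (n := n) hU hg (max B R)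
  have hle : ∀ k, ∀ t ∈ Icc 0 T, ‖(Impulsive.unstraighten g (ξ k t, w k t), w k t) -
      (Impulsive.unstraighten g (ζ t, u t), u t)‖ ≤ L * (|c k| + ‖w k t - u t‖) := by
    intro k t ht
    refine (hL (ξ k t, w k t) ⟨?_, mem_univ _, (hw k).mem t ht⟩ (ζ t, u t)
      ⟨?_, mem_univ _, hu.mem t ht⟩).trans ?_
    · exact mem_closedBall_zero_iff.2 (max_le_max (hξ k t ht) ((hw k).norm_le t ht))
    · exact mem_closedBall_zero_iff.2 (max_le_max (hζ t ht) (hu.norm_le t ht))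
    · refine mul_le_mul_of_nonneg_left (max_le ?_ ?_) hL0
      · exact ((hξζ k t ht).trans (le_abs_self _)).trans (le_add_of_nonneg_right (norm_nonneg _))
      · exact le_add_of_nonneg_left (abs_nonneg _)
  refine ⟨?_, fun t ht => ?_⟩
  · have hlim : Tendsto (fun k => ENNReal.ofReal L * (ENNReal.ofReal |c k| *
        volume (Icc 0 T) + eLpNorm (w k - u) 1 (volume.restrict (Icc 0 T)))) atTop (𝓝 0) := by
      have h1 : Tendsto (fun k => ENNReal.ofReal |c k|) atTop (𝓝 0) := by
        simpa using ENNReal.tendsto_ofReal hc.abs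
      have h2 := ENNReal.Tendsto.const_mul (a := ENNReal.ofReal L)
        ((ENNReal.Tendsto.mul_const (b := volume (Icc 0 T)) h1
          (Or.inr measure_Icc_lt_top.ne)).add hwu.1) (Or.inr ENNReal.ofReal_ne_top)
      simpa using h2
    refine tendsto_of_tendsto_of_tendsto_of_le_of_le tendsto_const_nhds hlim (fun _ => zero_le)
      fun k => ?_
    rw [eLpNorm_one_eq_lintegral_enorm, eLpNorm_one_eq_lintegral_enorm]
    calc _ ≤ ∫⁻ t in Icc 0 T, ENNReal.ofReal L * (ENNReal.ofReal |c k| + ‖(w k - u) t‖ₑ) := by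
          refine setLIntegral_mono_ae' measurableSet_Icc (Eventually.of_forall fun t ht => ?_)
          rw [← ofReal_norm, ← ofReal_norm,
            ← ENNReal.ofReal_add (abs_nonneg _) (norm_nonneg _), ← ENNReal.ofReal_mul hL0]
          exact ENNReal.ofReal_le_ofReal (hle k t ht)
      _ = _ := by
          rw [lintegral_const_mul' _ _ ENNReal.ofReal_ne_top, lintegral_add_left measurable_const,
            lintegral_const, Measure.restrict_apply_univ]
  · rw [tendsto_iff_norm_sub_tendsto_zero]
    have h1 := tendsto_iff_norm_sub_tendsto_zero.1 (hwu.2 t ht)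
    have hc' : Tendsto (fun k => |c k|) atTop (𝓝 0) := by simpa using hc.abs
    have h2 : Tendsto (fun k => L * (|c k| + ‖w k t - u t‖)) atTop (𝓝 0) := by
      simpa using (hc'.add h1).const_mul L
    exact squeeze_zero (fun _ => norm_nonneg _) (fun k => hle k t (hJ ht)) h2

/-- A bounded solution of the transformed problem gives an integrable function in the original
coordinates. -/
theorem integrableOn_unstraighten (hU : IsClosed U) (hg : FieldAssumption g U) {B R : ℝ}
    (hu : IsBoundedPath U R T u) {ζ : ℝ → Vec n} (hζc : ContinuousOn ζ (Icc 0 T))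
    (hζ : ∀ t ∈ Icc 0 T, ‖ζ t‖ ≤ B) :
    IntegrableOn (fun t => (unstraighten g (ζ t, u t), u t)) (Icc 0 T) := by
  have hK := isCompact_boundedCylinder (n := n) hU (max B R)
  obtain ⟨L, -, hL⟩ := exists_norm_unstraighten_sub_le (n := n) hU hg (max B R)
  obtain ⟨C, hC⟩ := hK.exists_bound_of_continuousOn (f := fun q => (unstraighten g q, q.2))
    (((unstraighten_locallyLipschitzOn hg).continuousOn.mono
      (boundedCylinder_subset _)).prodMk continuousOn_snd)
  have hmem : ∀ t ∈ Icc 0 T, (ζ t, u t) ∈ boundedCylinder n U (max B R) := fun t ht =>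
    ⟨mem_closedBall_zero_iff.2 (max_le_max (hζ t ht) (hu.norm_le t ht)), mem_univ _, hu.mem t ht⟩
  have hmem' : ∀ᵐ t ∂(volume.restrict (Icc 0 T)), (ζ t, u t) ∈ boundedCylinder n U (max B R) :=
    (ae_restrict_iff' measurableSet_Icc).2 (Eventually.of_forall hmem)
  refine Integrable.of_bound ?_ C (by filter_upwards [hmem'] with t ht using hC _ ht)
  -- the second argument of the composition is a dummy
  exact aestronglyMeasurable_comp₂ (Φ := fun (q : Vec n × Vec m) (_ : ℝ) => (unstraighten g q, q.2))
    hK.isClosed isClosed_univ (fun _ _ => hL) (fun _ _ => continuousOn_const)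
    ((hζc.aestronglyMeasurable measurableSet_Icc).prodMk hu.aestronglyMeasurable)
    (aestronglyMeasurable_const (b := (0 : ℝ))) hmem' (Eventually.of_forall fun _ => mem_univ _)

/-- The values of an impulsive control lie in a compact part of `U`, and it is approximated, also at
the times `0` and `τ`, by `C^1` controls with values there. -/
theorem IsImpulsiveControl.exists_approx (hU : IsClosed U) (hu : IsImpulsiveControl U T u) :
    ∃ R : ℝ, IsBoundedPath U R T u ∧ ∀ τ ∈ Icc 0 T, ∃ w : ℕ → ℝ → Vec m,
      (∀ k, IsC1Control U T (w k)) ∧ (∀ k, ∀ t ∈ Icc 0 T, ‖w k t‖ ≤ R) ∧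
      TendstoL1At T {0, τ} w u := by
  obtain ⟨hui, V, hVo, hVc, hVb, hVU, huV⟩ := hu
  obtain ⟨R, hR⟩ := hVb.exists_norm_le
  have hclR : closure V ⊆ Metric.closedBall 0 R :=
    closure_minimal (fun v hv => mem_closedBall_zero_iff.2 (hR v hv)) Metric.isClosed_closedBall
  refine ⟨R, ⟨hui.aestronglyMeasurable, fun t ht => closure_minimal hVU hU (huV t ht), fun t ht =>
    mem_closedBall_zero_iff.1 (hclR (huV t ht))⟩, fun τ hτ => ?_⟩
  obtain ⟨w, hw1, hw2, hw3⟩ := exists_contDiff_tendstoL1At hVo hVc hτ hui huV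
  exact ⟨w, fun k => ⟨(hw1 k).contDiffOn, fun t _ => hVU (hw2 k t)⟩,
    fun k t _ => hR _ (hw2 k t), hw3⟩

end

end Impulsive

end

open Impulsive in
theorem mainTheorem4 {n m l : ℕ} (T : ℝ) (hT : 0 < T)
    (U : Set (Vec m)) (hU : ∃ Ω : Set (Vec m), IsOpen Ω ∧ IsConnected Ω ∧ U = closure Ω)
    (A : Set (Vec l)) (hA : IsCompact A)
    (f : Vec n × Vec m → Vec l → Vec n) (hf : DriftAssumption f U A)
    (g : Fin m → Vec n × Vec m → Vec n) (hg : FieldAssumption g U)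
    (hbound : AprioriBound f g U A T)
    (x₀ : Vec n) (u : ℝ → Vec m) (hu : IsImpulsiveControl U T u)
    (a : ℝ → Vec l) (ha : IsOrdinaryControl A T a) :
    BijOn (coordChange g) (univ ×ˢ U) (univ ×ˢ U) ∧
    ∃ (p : ℝ → Vec n × Vec m) (ξ : ℝ → Vec n),
      IsGeneralizedSolution f g U T (Icc 0 T) x₀ u a p ∧
      (∀ p', IsGeneralizedSolution f g U T (Icc 0 T) x₀ u a p' → EqOn p' p (Icc 0 T)) ∧
      IsTransformedSolution f g U T x₀ u a ξ ∧
      (∀ ξ', IsTransformedSolution f g U T x₀ u a ξ' → EqOn ξ' ξ (Icc 0 T)) ∧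
      ∀ τ ∈ Icc 0 T, p τ = coordChangeInv g U (ξ τ, u τ) := by
  have hUc : IsClosed U := by
    obtain ⟨Ω, -, -, rfl⟩ := hU
    exact isClosed_closure
  refine ⟨bijOn_coordChange hg, ?_⟩
  have h0T : (0 : ℝ) ∈ Icc 0 T := ⟨le_rfl, hT.le⟩
  have hTT : T ∈ Icc 0 T := ⟨hT.le, le_rfl⟩
  obtain ⟨R, huR, happrox⟩ := hu.exists_approx hUc
  obtain ⟨B, hB0, hBinit, hBsol⟩ := exists_transformed_bound hT hUc hA hf hg hbound ha x₀ R
  have hB1 : 0 ≤ B + 1 := by linarith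
  obtain ⟨ξ, hξ0, hξ⟩ := exists_isClampedSolution hUc hA hf hg ha hT.le hB1 huR
    (straighten g (x₀, u 0))
  -- for each `τ`, the transformed solutions of approximating `C^1` controls, which obey the bound
  -- `B`, converge uniformly to `ξ`
  have hseq : ∀ τ ∈ Icc 0 T, ∃ (w : ℕ → ℝ → Vec m) (ζ : ℕ → ℝ → Vec n) (c : ℕ → ℝ),
      (∀ k, IsC1Control U T (w k)) ∧ (∀ k, ∀ t ∈ Icc 0 T, ‖w k t‖ ≤ R) ∧
      TendstoL1At T {0, τ} w u ∧ (∀ k, ∀ t ∈ Icc 0 T, ‖ζ k t‖ ≤ B) ∧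
      (∀ k, IsACSolution (fun t q => transF f g U (q, w k t) (a t)) T
        (straighten g (x₀, w k 0)) (ζ k)) ∧
      Tendsto c atTop (𝓝 0) ∧ ∀ k, ∀ t ∈ Icc 0 T, ‖ζ k t - ξ t‖ ≤ c k := by
    intro τ hτ
    obtain ⟨w, hw, hwR, hwu⟩ := happrox τ hτ
    choose ζ hζ0 hζ using fun k => exists_isClampedSolution hUc hA hf hg ha hT.le hB1
      ((hw k).isBoundedPath (hwR k)) (straighten g (x₀, w k 0))
    have hζB : ∀ k, ∀ t ∈ Icc 0 T, ‖ζ k t‖ ≤ B := fun k =>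
      (hζ k).norm_le hUc hA hf hg ha hB0 (hw k) (hwR k)
        (hBinit _ ((hw k).2 0 h0T) (hwR k 0 h0T)) (hBsol (w k) (hw k) (hwR k)) (hζ0 k)
    obtain ⟨c, hc, hcζ⟩ := exists_tendsto_clamped hUc hA hf hg ha hT.le hB1
      (fun k => (hw k).isBoundedPath (hwR k)) huR (by simp) hwu hζ hξ hζ0 hξ0
    refine ⟨w, ζ, c, hw, hwR, hwu, hζB, fun k => ?_, hc, hcζ⟩
    rw [← hζ0 k]
    exact (hζ k).isACSolution hUc hA hf hg ha hB1 ((hw k).isBoundedPath (hwR k)) hTT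
      fun t ht => (hζB k t ht).trans (by linarith)
  have hξB : ∀ t ∈ Icc 0 T, ‖ξ t‖ ≤ B := by
    intro t ht
    obtain ⟨w, ζ, c, -, -, -, hζB, -, hc, hcζ⟩ := hseq t ht
    have hlim : Tendsto (fun k => ζ k t) atTop (𝓝 (ξ t)) :=
      tendsto_iff_norm_sub_tendsto_zero.2
        (squeeze_zero (fun _ => norm_nonneg _) (fun k => hcζ k t ht) hc)
    exact le_of_tendsto hlim.norm (Eventually.of_forall fun k => hζB k t ht)
  have hξAC : IsTransformedSolution f g U T x₀ u a ξ := by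
    have := hξ.isACSolution hUc hA hf hg ha hB1 huR hTT
      fun t ht => (hξB t ht).trans (by linarith)
    rwa [hξ0] at this
  have hτJ : ∀ τ ∈ Icc 0 T, ({0, τ} : Set ℝ) ⊆ Icc 0 T := fun τ hτ => by
    rintro t (rfl | rfl)
    · exact h0T
    · exact hτ
  refine ⟨fun t => (unstraighten g (ξ t, u t), u t), ξ,
    ⟨integrableOn_unstraighten hUc hg huR hξ.continuousOn hξB, fun τ hτ => ?_⟩,
    fun p hp τ hτ => ?_, hξAC, fun ξ' hξ' τ hτ => ?_,
    fun τ hτ => (coordChangeInv_eq hg (q := (ξ τ, u τ)) (huR.mem τ hτ)).symm⟩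
  · obtain ⟨w, ζ, c, hw, hwR, hwu, hζB, hζ, hc, hcζ⟩ := hseq τ hτ
    refine ⟨w, fun k t => (unstraighten g (ζ k t, w k t), w k t), hw,
      fun k => isSmoothSolution_unstraighten hT hA hf hg ha (hw k) hTT (hζ k), ?_, hwu,
      hwu.unstraighten hUc hg (fun k => (hw k).isBoundedPath (hwR k)) huR (hτJ τ hτ) hζB hξB hc hcζ⟩
    obtain ⟨C, hC⟩ := (isCompact_boundedCylinder (n := n) hUc
      (max B R)).exists_bound_of_continuousOn (f := fun q => (unstraighten g q, q.2))
      (((unstraighten_locallyLipschitzOn hg).continuousOn.mono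
        (boundedCylinder_subset _)).prodMk continuousOn_snd)
    exact ⟨C, fun k t ht => hC (ζ k t, w k t) ⟨mem_closedBall_zero_iff.2
      (max_le_max (hζB k t ht) (hwR k t ht)), mem_univ _, (hw k).2 t ht⟩⟩
  · -- uniqueness: in the new coordinates any approximating trajectories converge uniformly to `ξ`,
    -- so their values at `τ` have only one possible limit
    obtain ⟨w, y, hw, hy, ⟨C, hC⟩, hwu, hyp⟩ := hp.2 τ hτ
    have hy2 : ∀ k, ∀ t ∈ Icc 0 T, (y k t).2 = w k t := fun k => (hy k).snd_eq (hw k) hTT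
    have hwC : ∀ k, ∀ t ∈ Icc 0 T, ‖w k t‖ ≤ max C R := fun k t ht => by
      rw [← hy2 k t ht]
      exact ((norm_snd_le _).trans (hC k t ht)).trans (le_max_left _ _)
    obtain ⟨B', hB'0, -, hB'⟩ := exists_transformed_bound hT hUc hA hf hg hbound ha x₀ (max C R)
    have hζ := fun k => (hy k).straighten hUc hA hf hg ha (hw k) hTT
    have hζB : ∀ k, ∀ t ∈ Icc 0 T, ‖straighten g (y k t)‖ ≤ max B' B := fun k t ht =>
      (hB' (w k) (hw k) (hwC k) T hTT _ (hζ k) t ht).trans (le_max_left _ _)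
    have hξB' : ∀ t ∈ Icc 0 T, ‖ξ t‖ ≤ max B' B := fun t ht => (hξB t ht).trans (le_max_right _ _)
    have huC : IsBoundedPath U (max C R) T u :=
      ⟨huR.1, huR.2, fun t ht => (huR.3 t ht).trans (le_max_right _ _)⟩
    have hwP := fun k => (hw k).isBoundedPath (hwC k)
    obtain ⟨c, hc, hcζ⟩ := exists_tendsto_clamped hUc hA hf hg ha hT.le
      (hB'0.trans (le_max_left B' B)) hwP huC (by simp) hwu
      (fun k => (hζ k).isClampedSolution hT.le (hζB k)) (hξAC.isClampedSolution hT.le hξB')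
      (fun k => (hζ k).initial hT.le) hξ0
    have hlim := (hwu.unstraighten hUc hg hwP huC (hτJ τ hτ) hζB hξB' hc hcζ).2 τ (by simp)
    have hlim' := hyp.2 τ (by simp)
    refine tendsto_nhds_unique hlim' (hlim.congr fun k => ?_)
    have hyk : y k τ = ((y k τ).1, w k τ) := Prod.ext rfl (hy2 k τ hτ)
    have hun := unstraighten_straighten hg (y k τ).1 ((hw k).2 τ hτ)
    rw [← hyk] at hun
    refine Eq.trans ?_ hyk.symm
    exact congrArg (fun x => (x, w k τ)) hun
  · -- two bounded solutions solve the same clamped problem, with the same control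
    obtain ⟨C, hC⟩ := isCompact_Icc.exists_bound_of_continuousOn
      (IsACSolution.continuousOn hT.le hξ')
    have h1 := IsACSolution.isClampedSolution (B := max C B) hT.le hξ'
      fun t ht => (hC t ht).trans (le_max_left _ _)
    have h2 := IsACSolution.isClampedSolution (B := max C B) hT.le hξAC
      fun t ht => (hξB t ht).trans (le_max_right _ _)
    obtain ⟨D, -, hD⟩ := exists_clamped_stability hUc hA hf hg ha R hT.le
      (hB0.trans (le_max_right C B))
    have h3 := hD u u ξ' ξ huR huR h1 h2 τ hτ
    rw [IsACSolution.initial hT.le hξ', hξ0] at h3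
    simpa [sub_eq_zero] using h3
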